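/- \textbf{Setting.} An LE-language $\mathcal L=\mathcal L(\mathcal F,\mathcal G)$ has connectives $h\in\mathcal F\cup\mathcal G$ of finite arity $n_h$ and order type $\varepsilon_h\in\{1,\partial\}^{n_h}$; its terms are built from countably many variables, $\bot,\top,\wedge,\vee$ and the connectives. Some connectives of $\mathcal L$ may be declared to be residuals of one another (e.g. $\circ,\backslash,/$). The fully residuated language $\mathcal L^*=\mathcal L(\mathcal F^*,\mathcal G^*)$ adds to $\mathcal L$ a residual of every connective in every coordinate. A perfect $\mathcal L$-algebra is a complete lattice, join-generated by its completely join-irreducible and meet-generated by its completely meet-irreducible elements, with operations for the connectives such that in each coordinate $i$ every $f\in\mathcal F$ turns arbitrary joins (meets, if $\varepsilon_f(i)=\partial$) into joins, every $g\in\mathcal G$ turns arbitrary meets (joins, if $\varepsilon_g(i)=\partial$) into meets, and declared residuals are residuals; the new connectives of $\mathcal L^*$ are interpreted as the corresponding adjoints. In the generation tree of a term with a signed root, children of $\wedge,\vee$ inherit the sign, and the $i$-th child of $h$ inherits the sign if $\varepsilon_h(i)=1$ and gets the opposite one if $\varepsilon_h(i)=\partial$. For an inequality $s\le t$ the trees $+s$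 and $-t$ are considered. Nodes $+f,-g$ are definite skeleton nodes, nodes $-f,+g$ are definite PIA nodes ($f\in\mathcal F$, $g\in\mathcal G$, resp. in $\mathcal F^*,\mathcal G^*$). For an order type $\varepsilon$ on the variables, a leaf $+p$ with $\varepsilon(p)=1$ or $-p$ with $\varepsilon(p)=\partial$ is $\varepsilon$-critical, and so is the branch that ends in it. For a strict partial order $\Omega$ on the variables, $s\le t$ is \emph{refined $(\Omega,\varepsilon)$-inductive} if (i) every $\varepsilon$-critical branch consists, from the root to the leaf, of definite skeleton nodes, then of $+\wedge$ and $-\vee$ nodes, then of definite PIA nodes; and (ii) every non-unary definite PIA node on a critical branch with leaf $p$ is an ancestor of exactly one critical leaf, and all other variables $q\neq p$ in its scope satisfy $q<_\Omega p$. A node of $\mathcal L^*$ is \emph{residuation-conservative} in coordinate $i$ if the residual of its connective in coordinate $i$ belongs to $\mathcal L$. For a leaf $l$ labelled with a variable $p$, $\mathsf{MVTree}^\varepsilon_\Omega(l)$ is the largest subtree containing $l$ that is either the leaf $l$ itself or satisfies: (1) the path from its root to $l$ contains (before $l$) only definite PIA nodes that are residuation-conservative in the coordinate containing $l$; (2)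 it contains no variable $q>_\Omega p$ and no $\varepsilon$-critical leaf; (3) its root is labelled with a connective of $\mathcal L^*$ not in $\mathcal L$; (4) its root does not lie on the path from the root of $\mathsf{MVTree}^\varepsilon_\Omega(l')$ to $l'$, for any variable leaf $l'$ to the left of $l$. An $\mathcal L^*$-inequality $\phi\le\psi$ is \emph{crypto $\mathcal L$-inductive} if for some order type $\varepsilon$ it is very simple $\varepsilon$-Sahlqvist (all $\varepsilon$-critical branches of $+\phi$ and $-\psi$ consist of definite skeleton nodes, apart from the leaf), all $\varepsilon$-critical branches contain only connectives of $\mathcal L$, and there is a strict partial order $\Omega$ on the variables such that every occurrence of a connective of $\mathcal L^*$ not in $\mathcal L$ lies on the path from the root of $\mathsf{MVTree}^\varepsilon_\Omega(l)$ to $l$ for some non-critical leaf $l$, and has an $\Omega$-largest variable in its scope. \textbf{Statement.} For every crypto $\mathcal L$-inductive $\mathcal L^*$-inequality $\phi\le\psi$ there are a strict partial order $\Omega'$, an order type $\varepsilon'$ and a refined $(\Omega',\varepsilon')$-inductive $\mathcal L$-inequality $s\le t$, in which no variable occurs uniformly (i.e. with the same sign in all its occurrences in $+s$ and $-t$), such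 that for every perfect $\mathcal L$-algebra $\mathbb A$: $\mathbb A\models\phi\le\psi$ if and only if $\mathbb A\models s\le t$. -/

import Mathlib

universe u v

/-! Conventions. Signs, order-type entries and families of connectives are all coded by `ℤˣ`:
* sign `+` is `1` and sign `-` is `-1`;
* order-type entry `1` is `1` and order-type entry `∂` is `-1`;
* the family `F` is `1` and the family `G` is `-1`. -/

/-- A lattice-expansion signature: a set of connectives, each of which belongs to `F` or to `G`
and has an arity and an order type. -/
structure LESig where
  Conn : Type u
  fam : Conn → ℤˣ
  arity : Conn → ℕ
  ord : (h : Conn) → Fin (arity h) → ℤˣ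

/-- An LE-language. Besides its signature, it records which of its own connectives (if any) are
residuals of each other, such as `∘`, `\`, `/` in the Lambek calculus: `Resid h i k e` says that
`k`, the coordinates of which correspond to those of `h` along `e`, is the residual of `h` in the
coordinate `i`. A language without such identifications has the empty relation. A residual has to
lie in the right family and to have the right order type: the residual in a coordinate `i` of
order type `1` lies in the opposite family, keeps the entry `i`, and flips the other entries; the
residual in a coordinate `i` of order type `∂` has the same family and the same order type. -/
structure LELang extends LESig.{u} where
  Resid : (h : Conn) → Fin (arity h) → (k : Conn) → (Fin (arity k) ≃ Fin (arity h)) → Prop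
  resid_fam : ∀ h i k e, Resid h i k e → fam k = -(ord h i) * fam h
  resid_ord_self : ∀ h i k e, Resid h i k e → ord k (e.symm i) = ord h i
  resid_ord_ne : ∀ h i k e, Resid h i k e →
    ∀ j, j ≠ i → ord k (e.symm j) = -(ord h i) * ord h j

/-- Terms over a signature; the propositional variables are the natural numbers. -/
inductive LETerm (S : LESig.{u}) : Type u
  | var (p : ℕ) : LETerm S
  | bot : LETerm S
  | top : LETerm S
  | meet (a b : LETerm S) : LETerm S
  | join (a b : LETerm S) : LETerm S
  | app (h : S.Conn) (args : Fin (S.arity h) → LETerm S) : LETerm S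

/-! ### The fully residuated language -/

/-- The connectives of `L*`: those of `L`, and a residual of each of them in each coordinate.
(When a residual of `h` in the coordinate `i` is already available in `L`, then `res h i` is just
another name for it.) -/
inductive StarConn (L : LELang.{u}) : Type u
  | base (h : L.Conn) : StarConn L
  | res (h : L.Conn) (i : Fin (L.arity h)) : StarConn L

namespace StarConn

variable {L : LELang.{u}}

def fam : StarConn L → ℤˣ
  | base h => L.fam h
  | res h i => -(L.ord h i) * L.fam h

abbrev arity : StarConn L → ℕ
  | base h => L.arity h
  | res h _ => L.arity h

def ord : (c : StarConn L) → Fin c.arity → ℤˣ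
  | base h => L.ord h
  | res h i => fun (j : Fin (L.arity h)) => if j = i then L.ord h i else -(L.ord h i) * L.ord h j

/-- The connective belongs to the base language `L`. -/
def InBase (c : StarConn L) : Prop := ∃ h : L.Conn, c = base h

end StarConn

/-- The signature of the fully residuated language `L*` of `L`. -/
abbrev LELang.star (L : LELang.{u}) : LESig.{u} where
  Conn := StarConn L
  fam := StarConn.fam
  arity := StarConn.arity
  ord := StarConn.ord

/-- `IsResidual c i d e`: the connective `d` of `L*`, with its coordinates matched to those of `c`
along `e`, is the residual of the connective `c` of `L*` in the coordinate `i`. If `c` has residual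
`d` in coordinate `i`, then `d` has residual `c` in that coordinate; if moreover `c` has residual
`d'` in a coordinate `j ≠ i`, then `d` has residual `d'` in coordinate `j`, with the
coordinates `i` and `j` interchanged (as for `y ≤ x \ z ↔ x ≤ z / y`). -/
inductive IsResidual {L : LELang.{u}} : (c : StarConn L) → Fin c.arity → (d : StarConn L) →
    (Fin d.arity ≃ Fin c.arity) → Prop
  | declared (h : L.Conn) (i : Fin (L.arity h)) (k : L.Conn)
      (e : Fin (L.arity k) ≃ Fin (L.arity h)) :
      L.Resid h i k e → IsResidual (.base h) i (.base k) e
  | formal (h : L.Conn) (i : Fin (L.arity h)) :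
      IsResidual (.base h) i (.res h i) (Equiv.refl _)
  | symm (c : StarConn L) (i : Fin c.arity) (d : StarConn L) (e : Fin d.arity ≃ Fin c.arity) :
      IsResidual c i d e → IsResidual d (e.symm i) c e.symm
  | swap (c : StarConn L) (i j : Fin c.arity) (d d' : StarConn L)
      (e : Fin d.arity ≃ Fin c.arity) (e' : Fin d'.arity ≃ Fin c.arity) :
      i ≠ j → IsResidual c i d e → IsResidual c j d' e' →
      IsResidual d (e.symm j) d' (e'.trans ((Equiv.swap i j).trans e.symm))

/-- Residuation-conservativity of a connective of `L*` in the coordinate `i`: its residual in that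
coordinate belongs to `L`. -/
def ResidConservative {L : LELang.{u}} (c : StarConn L) (i : Fin c.arity) : Prop :=
  ∃ (d : StarConn L) (e : Fin d.arity ≃ Fin c.arity), d.InBase ∧ IsResidual c i d e

/-! ### Signed generation trees -/

namespace LETerm

variable {S : LESig.{u}}

/-- The `i`-th immediate subterm, with the sign by which the sign of the node is multiplied. -/
def child : LETerm S → ℕ → Option (ℤˣ × LETerm S)
  | .app h args, i => if hi : i < S.arity h then some (S.ord h ⟨i, hi⟩, args ⟨i, hi⟩) else none
  | .meet a b, i => if i = 0 then some (1, a) else if i = 1 then some (1, b) else none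
  | .join a b, i => if i = 0 then some (1, a) else if i = 1 then some (1, b) else none
  | .var _, _ => none
  | .bot, _ => none
  | .top, _ => none

/-- The signed subtree at the node `π` of the generation tree of `t` with root sign `s`; a node is
given by the list of coordinates that leads to it from the root. The value is `none` if there is
no such node. -/
def nodeAt (s : ℤˣ) (t : LETerm S) : List ℕ → Option (ℤˣ × LETerm S)
  | [] => some (s, t)
  | i :: π =>
    match t.child i with
    | some (e, a) => nodeAt (s * e) a π
    | none => none

/-- The variable `p` occurs in `t`. -/
def Occurs (p : ℕ) (t : LETerm S) : Prop := ∃ (l : List ℕ) (σ : ℤˣ), t.nodeAt 1 l = some (σ, .var p)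

/-- `l` is an `ε`-critical leaf, labelled with `p`, of the tree of `t` with root sign `s`. -/
def IsCritical (ε : ℕ → ℤˣ) (s : ℤˣ) (t : LETerm S) (l : List ℕ) (p : ℕ) : Prop :=
  t.nodeAt s l = some (ε p, .var p)

/-- The node `π` is a definite skeleton node `+f` or `-g`. -/
def IsDefSkeleton (s : ℤˣ) (t : LETerm S) (π : List ℕ) : Prop :=
  ∃ (h : S.Conn) (args : Fin (S.arity h) → LETerm S), t.nodeAt s π = some (S.fam h, .app h args)

/-- The node `π` is a definite PIA node `+g` or `-f`. -/
def IsDefPIA (s : ℤˣ) (t : LETerm S) (π : List ℕ) : Prop :=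
  ∃ (h : S.Conn) (args : Fin (S.arity h) → LETerm S), t.nodeAt s π = some (-S.fam h, .app h args)

/-- The node `π` is a `+∧` node or a `-∨` node. -/
def IsPlusMeetOrMinusJoin (s : ℤˣ) (t : LETerm S) (π : List ℕ) : Prop :=
  ∃ a b : LETerm S, t.nodeAt s π = some (1, .meet a b) ∨ t.nodeAt s π = some (-1, .join a b)

/-- The branch ending in the leaf `l` is refined good: going from the root to the leaf, it consists
of definite skeleton nodes, then of `+∧` and `-∨` nodes, then of definite PIA nodes. -/
def IsRefinedGood (s : ℤˣ) (t : LETerm S) (l : List ℕ) : Prop :=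
  ∃ a b : ℕ, ∀ k < l.length,
    (k < a → t.IsDefSkeleton s (l.take k)) ∧
    (a ≤ k → k < b → t.IsPlusMeetOrMinusJoin s (l.take k)) ∧
    (a ≤ k → b ≤ k → t.IsDefPIA s (l.take k))

/-- The signed generation tree of `t` with root sign `s` is refined `(Ω, ε)`-inductive. In the
second clause `π` is an SRR node (a non-unary `+g` or `-f` node) on the critical branch of `l`. -/
def IsRefinedInductiveTree (Ω : ℕ → ℕ → Prop) (ε : ℕ → ℤˣ) (s : ℤˣ) (t : LETerm S) : Prop :=
  (∀ l p, t.IsCritical ε s l p → t.IsRefinedGood s l) ∧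
  (∀ (l π : List ℕ) (p : ℕ) (h : S.Conn) (args : Fin (S.arity h) → LETerm S),
    t.IsCritical ε s l p → π <+: l →
    t.nodeAt s π = some (-S.fam h, .app h args) → S.arity h ≠ 1 →
      (∀ l' p', t.IsCritical ε s l' p' → π <+: l' → l' = l) ∧
      (∀ q, (LETerm.app h args).Occurs q → q ≠ p → Ω q p))

/-- The variable `p` occurs with sign `σ` in the signed generation trees `+s` and `-t`. -/
def OccursSigned (s t : LETerm S) (p : ℕ) (σ : ℤˣ) : Prop :=
  (∃ l, s.nodeAt 1 l = some (σ, .var p)) ∨ (∃ l, t.nodeAt (-1) l = some (σ, .var p))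

end LETerm

/-- `Ω` is a strict partial order (irreflexive and transitive). -/
def IsStrictPO (Ω : ℕ → ℕ → Prop) : Prop :=
  (∀ p, ¬ Ω p p) ∧ (∀ p q r, Ω p q → Ω q r → Ω p r)

/-- The inequality `s ≤ t` is refined `(Ω, ε)`-inductive. -/
def IsRefinedInductiveFor {S : LESig.{u}} (Ω : ℕ → ℕ → Prop) (ε : ℕ → ℤˣ) (s t : LETerm S) :
    Prop :=
  IsStrictPO Ω ∧ s.IsRefinedInductiveTree Ω ε 1 ∧ t.IsRefinedInductiveTree Ω ε (-1)

/-- The inequality `s ≤ t` is refined inductive with respect to `Ω` and `ε`: it is refined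
`(Ω, ε)`-inductive, and no variable occurs uniformly in it. -/
def IsRefinedInductive {S : LESig.{u}} (Ω : ℕ → ℕ → Prop) (ε : ℕ → ℤˣ) (s t : LETerm S) : Prop :=
  IsRefinedInductiveFor Ω ε s t ∧
    ∀ p σ, LETerm.OccursSigned s t p σ → LETerm.OccursSigned s t p (-σ)

/-! ### Crypto-inductive inequalities -/

namespace LETerm

variable {L : LELang.{u}}

/-- All critical branches of the tree consist of definite skeleton nodes. -/
def IsVerySimpleSahlqvistTree {S : LESig.{u}} (ε : ℕ → ℤˣ) (s : ℤˣ) (t : LETerm S) : Prop :=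
  ∀ l p, t.IsCritical ε s l p → ∀ π, π <+: l → π ≠ l → t.IsDefSkeleton s π

/-- All critical branches of the tree contain only connectives of `L`. -/
def CriticalBranchesInBase (ε : ℕ → ℤˣ) (s : ℤˣ) (t : LETerm L.star) : Prop :=
  ∀ l p, t.IsCritical ε s l p → ∀ (π : List ℕ) (σ : ℤˣ) (c : StarConn L)
    (args : Fin c.arity → LETerm L.star),
    π <+: l → t.nodeAt s π = some (σ, .app (S := L.star) c args) → c.InBase

/-- `IsMVCandidate Ω ε s t τ l p n`: the subtree rooted in the node `n` is admissible as
`MVTree(l)`, where `l` is a leaf labelled with the variable `p` and `τ l'` is the root of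
`MVTree(l')` for each leaf `l'` to the left of `l`. Thus either `n` is the leaf `l` itself, or `n`
is a proper ancestor of `l` such that
1. the path from `n` to `l` contains only `-f` and `+g` nodes that are residuation-conservative in
   the coordinate through which the path continues;
2. no variable `q` with `p <_Ω q` and no critical leaf occurs below `n`;
3. the node `n` is labelled with a connective of `L*` that is not in `L`;
4. `n` does not lie on the path from the root of `MVTree(l')` to `l'`, for any variable leaf `l'` to
   the left of `l` (for leaves, this is the lexicographic order of positions). -/
def IsMVCandidate (Ω : ℕ → ℕ → Prop) (ε : ℕ → ℤˣ) (s : ℤˣ) (t : LETerm L.star)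
    (τ : List ℕ → List ℕ) (l : List ℕ) (p : ℕ) (n : List ℕ) : Prop :=
  n = l ∨
  (n <+: l ∧ n ≠ l ∧
    (∀ (π : List ℕ) (i : ℕ), n <+: π → π ++ [i] <+: l →
      ∃ (c : StarConn L) (args : Fin c.arity → LETerm L.star) (hi : i < c.arity),
        t.nodeAt s π = some (-c.fam, .app (S := L.star) c args) ∧ ResidConservative c ⟨i, hi⟩) ∧
    (∀ (l' : List ℕ) (σ : ℤˣ) (q : ℕ), n <+: l' → t.nodeAt s l' = some (σ, .var q) →
      ¬ Ω p q ∧ σ ≠ ε q) ∧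
    (∃ (σ : ℤˣ) (c : StarConn L) (args : Fin c.arity → LETerm L.star),
      t.nodeAt s n = some (σ, .app (S := L.star) c args) ∧ ¬ c.InBase) ∧
    (∀ (l' : List ℕ) (σ : ℤˣ) (q : ℕ), t.nodeAt s l' = some (σ, .var q) → l' < l →
      ¬ (τ l' <+: n ∧ n <+: l')))

/-- `τ` assigns to each variable leaf `l` of the tree the root of `MVTree(l)`, i.e. the highest
admissible node. (The conditions on `τ l` only involve the values of `τ` on leaves to the left of
`l`; so there is such a `τ`, and its values on the variable leaves are unique.) -/
def IsMVAssignment (Ω : ℕ → ℕ → Prop) (ε : ℕ → ℤˣ) (s : ℤˣ) (t : LETerm L.star)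
    (τ : List ℕ → List ℕ) : Prop :=
  ∀ (l : List ℕ) (σ : ℤˣ) (p : ℕ), t.nodeAt s l = some (σ, .var p) →
    t.IsMVCandidate Ω ε s τ l p (τ l) ∧ ∀ n, t.IsMVCandidate Ω ε s τ l p n → τ l <+: n

/-- Every occurrence of a connective of `L*` that is not in `L` lies on the path from the root of
`MVTree(l)` to `l` for some non-critical leaf `l`, and there is an `Ω`-largest variable in its
scope. -/
def NewConnectivesExtractable (Ω : ℕ → ℕ → Prop) (ε : ℕ → ℤˣ) (s : ℤˣ) (t : LETerm L.star) :
    Prop :=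
  ∃ τ : List ℕ → List ℕ, t.IsMVAssignment Ω ε s τ ∧
    ∀ (π : List ℕ) (σ : ℤˣ) (c : StarConn L) (args : Fin c.arity → LETerm L.star),
      t.nodeAt s π = some (σ, .app (S := L.star) c args) → ¬ c.InBase →
        (∃ (l : List ℕ) (σ' : ℤˣ) (p : ℕ), t.nodeAt s l = some (σ', .var p) ∧ σ' ≠ ε p ∧
          τ l <+: π ∧ π <+: l) ∧
        (∃ r, (LETerm.app (S := L.star) c args).Occurs r ∧
          ∀ q, (LETerm.app (S := L.star) c args).Occurs q → q ≠ r → Ω q r)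

end LETerm

/-- The `L*`-inequality `φ ≤ ψ` is crypto `L`-inductive. -/
def IsCryptoInductive {L : LELang.{u}} (φ ψ : LETerm L.star) : Prop :=
  ∃ ε : ℕ → ℤˣ,
    (φ.IsVerySimpleSahlqvistTree ε 1 ∧ ψ.IsVerySimpleSahlqvistTree ε (-1)) ∧
    (φ.CriticalBranchesInBase ε 1 ∧ ψ.CriticalBranchesInBase ε (-1)) ∧
    ∃ Ω : ℕ → ℕ → Prop, IsStrictPO Ω ∧
      φ.NewConnectivesExtractable Ω ε 1 ∧ ψ.NewConnectivesExtractable Ω ε (-1)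

/-! ### Perfect lattice expansions -/

/-- `a ≤ b` for the sign `1`, and `b ≤ a` for the sign `-1`. -/
def signedLE {A : Type v} [LE A] (s : ℤˣ) (a b : A) : Prop := if s = 1 then a ≤ b else b ≤ a

/-- The join of `X` for the sign `1`, and the meet of `X` for the sign `-1`. -/
noncomputable def signedSup {A : Type v} [CompleteLattice A] (s : ℤˣ) (X : Set A) : A :=
  if s = 1 then sSup X else sInf X

def ComplJoinIrred {A : Type v} [CompleteLattice A] (j : A) : Prop := ∀ X : Set A, j = sSup X → j ∈ X

def ComplMeetIrred {A : Type v} [CompleteLattice A] (m : A) : Prop := ∀ X : Set A, m = sInf X → m ∈ X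

/-- A perfect `L`-algebra structure on a complete lattice `A`: the lattice is perfect, the
connectives in `F` turn arbitrary joins (meets, in the coordinates of order type `∂`) into joins,
those in `G` turn arbitrary meets (joins, in the coordinates of order type `∂`) into meets, and those
connectives of `L` that the language declares to be residuals of each other are so. -/
structure PerfectLE (L : LELang.{u}) (A : Type v) [CompleteLattice A] where
  join_generated : ∀ a : A, a = sSup {j | ComplJoinIrred j ∧ j ≤ a}
  meet_generated : ∀ a : A, a = sInf {m | ComplMeetIrred m ∧ a ≤ m}
  op : (h : L.Conn) → (Fin (L.arity h) → A) → A
  distrib : ∀ (h : L.Conn) (i : Fin (L.arity h)) (x : Fin (L.arity h) → A) (X : Set A),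
    op h (Function.update x i (signedSup (L.fam h * L.ord h i) X)) =
      signedSup (L.fam h) ((fun a => op h (Function.update x i a)) '' X)
  residuated : ∀ h i k e, L.Resid h i k e → ∀ (x : Fin (L.arity h) → A) (z : A),
    signedLE (L.fam h) (op h x) z ↔
      signedLE (L.fam h * L.ord h i) (x i) (op k (Function.update x i z ∘ e))

/-- The value of a term under a valuation of the variables, for a given interpretation of the
connectives. -/
def LETerm.eval {S : LESig.{u}} {A : Type v} [CompleteLattice A]
    (op : (h : S.Conn) → (Fin (S.arity h) → A) → A) (val : ℕ → A) : LETerm S → A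
  | .var p => val p
  | .bot => ⊥
  | .top => ⊤
  | .meet a b => a.eval op val ⊓ b.eval op val
  | .join a b => a.eval op val ⊔ b.eval op val
  | .app h args => op h (fun i => (args i).eval op val)

/-- The interpretation of the connectives of `L*` in a perfect `L`-algebra. The new connectives are
interpreted as the adjoints: e.g. for `f ∈ F` with order type `1` in the coordinate `i`, the value
at `x` of the residual is the largest `a` with `f(x[a/x_i]) ≤ x_i`. -/
noncomputable def PerfectLE.starOp {L : LELang.{u}} {A : Type v} [CompleteLattice A]
    (M : PerfectLE L A) : (c : StarConn L) → (Fin c.arity → A) → A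
  | .base h => M.op h
  | .res h i => fun x =>
      signedSup (L.fam h * L.ord h i)
        {a | signedLE (L.fam h) (M.op h (Function.update x i a)) (x i)}

/-- Validity of an `L`-inequality in a perfect `L`-algebra. -/
def PerfectLE.Valid {L : LELang.{u}} {A : Type v} [CompleteLattice A] (M : PerfectLE L A)
    (s t : LETerm L.toLESig) : Prop :=
  ∀ val : ℕ → A, s.eval M.op val ≤ t.eval M.op val

/-- Validity of an `L*`-inequality in a perfect `L`-algebra. -/
def PerfectLE.StarValid {L : LELang.{u}} {A : Type v} [CompleteLattice A] (M : PerfectLE L A)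
    (φ ψ : LETerm L.star) : Prop :=
  ∀ val : ℕ → A, φ.eval (S := L.star) M.starOp val ≤ ψ.eval (S := L.star) M.starOp val

/-!
Every non-critical leaf `l` gets a fresh variable `x`, which replaces `MVTree(l)` (the leaf itself,
if that tree is trivial). Let `p` be the label of `l`. Since `MVTree(l)` occurs in a monotone
context (up to sign), the instance of the inequality at `MVTree(l)` follows from those at all `x`
below it. The path from the root of `MVTree(l)` to `l` consists of PIA nodes whose residuals in the
direction of the path belong to `L`, so the inequality `x ≤ MVTree(l)` can be solved for `p`: it
amounts to a bound of `p` by an `L`-term, `CryptoData.solution`, in `x` and the fresh variables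
beside the path. The bounds for all leaves labelled with `p` amount to a bound of `p` by the join
(or meet) of these terms, `CryptoData.minimalValuation`. The remaining occurrences of `p` are the
critical ones, at which the inequality is strongest when `p` equals this bound; so they can be
replaced by it. The result, `CryptoData.result`, has fresh variables only, so that no iteration is
needed. Both directions of the equivalence are instances of `LETerm.Extractable.signedLE_eval`,
together with `LETerm.IsInvertible.signedLE_invert` and `LETerm.IsInvertible.signedLE_of_invert`
(see `CryptoData.result_signedLE` and `CryptoData.signedLE_result`).

All new connectives have disappeared, since each of them lies on the path to `l` in some
`MVTree(l)`. These paths are pairwise disjoint (`LETerm.IsMVAssignment.disjoint`), hence the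
subtrees beside one of them can be treated in the same way.

The result is refined inductive: at the end of a definite skeleton branch of the original inequality
a minimal valuation is attached, that is, `+∧` or `-∨` nodes followed by solutions, and in a
solution the residuals of PIA nodes form a PIA branch that ends in `x`. The occurrences of fresh
variables in place of the `MVTree`s and beside the paths are non-critical. A fresh variable beside
the path of `l` belongs to a leaf whose label is `<_Ω p`, because the label of `l` is the largest
one in `MVTree(l)`, or to a leaf with the same label but a smaller subtree. So the labels together
with inclusion of subtrees give the required order, `CryptoData.newOrder`. Finally, variables that
occur uniformly are replaced by constants (`exists_isRefinedInductive`).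
-/

/-! ### Signed inequalities -/

section Signed

variable {A : Type v}

theorem signedLE_neg [LE A] (s : ℤˣ) (a b : A) : signedLE (-s) a b ↔ signedLE s b a := by
  rcases Int.units_eq_one_or s with rfl | rfl <;> simp [signedLE]

theorem signedLE_refl [Preorder A] (s : ℤˣ) (a : A) : signedLE s a a := by
  simp [signedLE]

theorem signedLE.trans [Preorder A] {s : ℤˣ} {a b c : A} (h : signedLE s a b)
    (h' : signedLE s b c) : signedLE s a c := by
  unfold signedLE at *
  split_ifs at * with hs
  · exact h.trans h'
  · exact h'.trans h

theorem signedLE_signedSup [CompleteLattice A] {s : ℤˣ} {X : Set A} {a : A} (ha : a ∈ X) :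
    signedLE s a (signedSup s X) := by
  unfold signedLE signedSup
  split_ifs
  · exact le_sSup ha
  · exact sInf_le ha

theorem signedSup_signedLE [CompleteLattice A] {s : ℤˣ} {X : Set A} {b : A}
    (h : ∀ a ∈ X, signedLE s a b) : signedLE s (signedSup s X) b := by
  unfold signedLE signedSup at *
  split_ifs at * with hs
  · exact sSup_le h
  · exact le_sInf h

theorem signedSup_pair [CompleteLattice A] {s : ℤˣ} {a b : A} (h : signedLE s a b) :
    signedSup s {a, b} = b := by
  unfold signedLE signedSup at *
  split_ifs at * with hs
  · simpa [sSup_pair] using h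
  · simpa [sInf_pair] using h

/-- A map that is monotone in each coordinate, up to signs, is monotone. -/
theorem signedLE_of_coordinatewise [Preorder A] {n : ℕ} (f : (Fin n → A) → A) (δ : Fin n → ℤˣ)
    (σ : ℤˣ)
    (hf : ∀ i x a b, signedLE (δ i) a b →
      signedLE σ (f (Function.update x i a)) (f (Function.update x i b)))
    {x y : Fin n → A} (h : ∀ i, signedLE (δ i) (x i) (y i)) : signedLE σ (f x) (f y) := by
  have key : ∀ s : Finset (Fin n), signedLE σ (f x) (f (s.piecewise y x)) := by
    intro s
    induction s using Finset.induction_on with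
    | empty => simpa using signedLE_refl σ (f x)
    | insert j s hj ih =>
      refine ih.trans ?_
      rw [Finset.piecewise_insert]
      have h1 : s.piecewise y x = Function.update (s.piecewise y x) j (x j) := by
        rw [eq_comm, Function.update_eq_self_iff]
        simp [hj]
      nth_rewrite 1 [h1]
      exact hf _ _ _ _ (h j)
  simpa using key Finset.univ

end Signed

/-! ### Monotonicity and residuation in perfect algebras -/

namespace PerfectLE

variable {L : LELang.{u}} {A : Type v} [CompleteLattice A] (M : PerfectLE L A)

theorem op_update_mono (h : L.Conn) (i : Fin (L.arity h)) (x : Fin (L.arity h) → A) {a b : A}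
    (hab : signedLE (L.fam h * L.ord h i) a b) :
    signedLE (L.fam h) (M.op h (Function.update x i a)) (M.op h (Function.update x i b)) := by
  have h1 := M.distrib h i x {a, b}
  rw [signedSup_pair hab] at h1
  rw [h1]
  exact signedLE_signedSup ⟨a, by simp, rfl⟩

theorem op_mono (h : L.Conn) (σ : ℤˣ) {x y : Fin (L.arity h) → A}
    (hxy : ∀ i, signedLE (σ * L.ord h i) (x i) (y i)) :
    signedLE σ (M.op h x) (M.op h y) := by
  refine signedLE_of_coordinatewise (M.op h) (fun i => σ * L.ord h i) σ ?_ hxy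
  intro i x a b hab
  rcases eq_or_ne σ (L.fam h) with rfl | hσ
  · exact M.op_update_mono h i x hab
  · obtain rfl : σ = -L.fam h := Int.units_ne_iff_eq_neg.mp hσ
    rw [signedLE_neg]
    rw [neg_mul, signedLE_neg] at hab
    exact M.op_update_mono h i x hab

/-- The new connective `res h i` is interpreted as the residual of `h` in the coordinate `i`. -/
theorem starOp_res_iff (h : L.Conn) (i : Fin (L.arity h)) (x : Fin (L.arity h) → A) (z : A) :
    signedLE (L.fam h) (M.op h x) z ↔
      signedLE (L.fam h * L.ord h i) (x i) (M.starOp (.res h i) (Function.update x i z)) := by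
  simp only [starOp, Function.update_idem, Function.update_self]
  constructor
  · intro hx
    refine signedLE_signedSup ?_
    simpa using hx
  · intro hx
    have h1 := M.op_update_mono h i x hx
    rw [Function.update_eq_self, M.distrib] at h1
    refine h1.trans (signedSup_signedLE ?_)
    rintro _ ⟨a, ha, rfl⟩
    exact ha

theorem starOp_mono (c : StarConn L) (σ : ℤˣ) {x y : Fin c.arity → A}
    (hxy : ∀ i, signedLE (σ * c.ord i) (x i) (y i)) :
    signedLE σ (M.starOp c x) (M.starOp c y) := by
  cases c with
  | base h => exact M.op_mono h σ hxy
  | res h i =>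
    have key : ∀ x y : Fin (L.arity h) → A,
        (∀ j, signedLE (L.fam h * L.ord h i * StarConn.ord (.res h i) j) (x j) (y j)) →
        signedLE (L.fam h * L.ord h i) (M.starOp (.res h i) x) (M.starOp (.res h i) y) := by
      intro x y hxy
      have hi := hxy i
      simp only [StarConn.ord, if_true, mul_assoc, Int.units_mul_self, mul_one] at hi
      have h1 := M.starOp_res_iff h i (Function.update y i (M.starOp (.res h i) x)) (y i)
      have h2 := M.starOp_res_iff h i (Function.update x i (M.starOp (.res h i) x)) (x i)
      simp only [Function.update_idem, Function.update_self, Function.update_eq_self] at h1 h2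
      rw [← h1]
      refine (M.op_mono h (L.fam h) ?_).trans ((h2.mpr (signedLE_refl _ _)).trans hi)
      intro j
      by_cases hj : j = i
      · subst hj
        simpa using signedLE_refl _ _
      · have := hxy j
        have e : L.fam h * L.ord h i * -(L.ord h i * L.ord h j) = -(L.fam h * L.ord h j) := by
          rw [mul_neg, mul_assoc, ← mul_assoc (L.ord h i), Int.units_mul_self, one_mul]
        simp only [StarConn.ord, hj, if_false, neg_mul] at this
        rw [e, signedLE_neg] at this
        simpa [hj] using this
    rcases eq_or_ne σ (L.fam h * L.ord h i) with rfl | hσ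
    · exact key x y hxy
    · obtain rfl : σ = -(L.fam h * L.ord h i) := Int.units_ne_iff_eq_neg.mp hσ
      rw [signedLE_neg]
      refine key y x fun j => ?_
      have := hxy j
      rwa [neg_mul, signedLE_neg] at this

end PerfectLE

theorem IsResidual.signs {L : LELang.{u}} {c : StarConn L} {i : Fin c.arity} {d : StarConn L}
    {e : Fin d.arity ≃ Fin c.arity} (hr : IsResidual c i d e) :
    d.fam = -(c.ord i) * c.fam ∧ d.ord (e.symm i) = c.ord i ∧
      ∀ j, j ≠ i → d.ord (e.symm j) = -(c.ord i) * c.ord j := by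
  induction hr with
  | declared h i k e hk =>
    exact ⟨L.resid_fam _ _ _ _ hk, L.resid_ord_self _ _ _ _ hk, L.resid_ord_ne _ _ _ _ hk⟩
  | formal h i =>
    refine ⟨rfl, by simp [StarConn.ord], fun j hj => ?_⟩
    simp [StarConn.ord, hj]
  | symm c i d e _ ih =>
    obtain ⟨h1, h2, h3⟩ := ih
    refine ⟨?_, by simp [h2], fun j hj => ?_⟩
    · rw [h2, h1, ← mul_assoc, neg_mul_neg, Int.units_mul_self, one_mul]
    · have := h3 (e j) (fun hji => hj (by rw [← hji]; simp))
      rw [Equiv.symm_apply_apply] at this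
      rw [h2, this, ← mul_assoc, neg_mul_neg, Int.units_mul_self, one_mul]
      simp
  | swap c i j d d' e e' hij _ _ ih ih' =>
    obtain ⟨h1, h2, h3⟩ := ih
    obtain ⟨h1', h2', h3'⟩ := ih'
    have hdj := h3 j hij.symm
    refine ⟨?_, ?_, fun k hk => ?_⟩
    · rw [hdj, h1, h1']
      rcases Int.units_eq_one_or (c.ord i) with h | h <;> simp [h]
    · have : (e'.trans ((Equiv.swap i j).trans e.symm)).symm (e.symm j) = e'.symm i := by simp
      rw [this, h3' i hij, hdj]
      simp [mul_comm]
    · have hkj : e k ≠ j := fun h => hk (by rw [← h]; simp)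
      have : (e'.trans ((Equiv.swap i j).trans e.symm)).symm k = e'.symm (Equiv.swap i j (e k)) := by
        simp
      rw [this, hdj]
      by_cases hki : e k = i
      · have hk' : k = e.symm i := by rw [← hki]; simp
        rw [hki, Equiv.swap_apply_left, h2', hk', h2]
        rcases Int.units_eq_one_or (c.ord i) with h | h <;> simp [h]
      · rw [Equiv.swap_apply_of_ne_of_ne hki hkj, h3' _ hkj]
        have := h3 _ hki
        rw [Equiv.symm_apply_apply] at this
        rw [this]
        rcases Int.units_eq_one_or (c.ord i) with h | h <;> simp [h]

/-- The syntactic residuation relation between connectives of `L*` is sound: it is an adjunction in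
every perfect algebra. -/
theorem IsResidual.signedLE_iff {L : LELang.{u}} {A : Type v} [CompleteLattice A]
    (M : PerfectLE L A) {c : StarConn L} {i : Fin c.arity} {d : StarConn L}
    {e : Fin d.arity ≃ Fin c.arity} (hr : IsResidual c i d e) :
    ∀ (x : Fin c.arity → A) (z : A), signedLE c.fam (M.starOp c x) z ↔
      signedLE (c.fam * c.ord i) (x i) (M.starOp d (Function.update x i z ∘ e)) := by
  induction hr with
  | declared h i k e hk => exact M.residuated h i k e hk
  | formal h i => exact M.starOp_res_iff h i
  | symm c i d e hr ih =>
    intro y z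
    have h := ih (Function.update y (e.symm i) z ∘ e.symm) (y (e.symm i))
    obtain ⟨h1, h2, -⟩ := hr.signs
    have e1 : Function.update (Function.update y (e.symm i) z ∘ e.symm) i (y (e.symm i)) ∘ e = y := by
      funext k
      by_cases hk : e k = i
      · have hk' : k = e.symm i := by rw [← hk]; simp
        simp [hk']
      · have hk' : k ≠ e.symm i := fun h => hk (by rw [h]; simp)
        simp [hk, hk']
    have e2 : d.fam * d.ord (e.symm i) = -c.fam := by
      rw [h1, h2]
      rcases Int.units_eq_one_or (c.ord i) with h | h <;> simp [h]
    have e3 : d.fam = -(c.fam * c.ord i) := by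
      rw [h1, neg_mul, mul_comm]
    rw [e1] at h
    simp only [Function.comp_apply, Function.update_self] at h
    rw [e2, signedLE_neg, e3, signedLE_neg, ← h]
  | swap c i j d d' e e' hij hr hr' ih ih' =>
    intro y z
    obtain ⟨h1, h2, h3⟩ := hr.signs
    have h := ih (Function.update (y ∘ e.symm) i z) (y (e.symm i))
    have h' := ih' (Function.update (y ∘ e.symm) i z) (y (e.symm i))
    have e1 : Function.update (Function.update (y ∘ e.symm) i z) i (y (e.symm i)) ∘ e = y := by
      funext k
      by_cases hk : e k = i
      · have hk' : k = e.symm i := by rw [← hk]; simp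
        simp [hk']
      · simp [hk]
    have e2 : Function.update (Function.update (y ∘ e.symm) i z) j (y (e.symm i)) ∘ e' =
        Function.update y (e.symm j) z ∘ (e'.trans ((Equiv.swap i j).trans e.symm)) := by
      funext k
      by_cases hj : e' k = j
      · simp [hj, hij]
      · by_cases hi : e' k = i
        · simp [hi, hij]
        · simp [hi, hj, Equiv.swap_apply_of_ne_of_ne hi hj]
    have e3 : d.fam = -(c.fam * c.ord i) := by
      rw [h1, neg_mul, mul_comm]
    have e4 : d.fam * d.ord (e.symm j) = c.fam * c.ord j := by
      rw [h1, h3 j hij.symm]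
      rcases Int.units_eq_one_or (c.ord i) with h | h <;> simp [h]
    rw [e1, Function.update_self] at h
    rw [e2, Function.update_of_ne hij.symm, Function.comp_apply] at h'
    rw [e4, ← h', h, e3, signedLE_neg]

/-! ### Positions in signed generation trees -/

namespace LETerm

variable {S : LESig.{u}}

theorem nodeAt_append (s : ℤˣ) (t : LETerm S) (π ρ : List ℕ) :
    t.nodeAt s (π ++ ρ) = (t.nodeAt s π).bind fun r => r.2.nodeAt r.1 ρ := by
  induction π generalizing s t with
  | nil => simp [nodeAt]
  | cons i π ih =>
    simp only [List.cons_append, nodeAt]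
    cases t.child i with
    | none => simp
    | some r => simp [ih]

theorem nodeAt_append_of {s : ℤˣ} {t : LETerm S} {π : List ℕ} {σ : ℤˣ} {a : LETerm S}
    (h : t.nodeAt s π = some (σ, a)) (ρ : List ℕ) : t.nodeAt s (π ++ ρ) = a.nodeAt σ ρ := by
  rw [nodeAt_append, h]; rfl

theorem nodeAt_isSome_of_prefix {s : ℤˣ} {t : LETerm S} {π l : List ℕ} {r : ℤˣ × LETerm S}
    (h : t.nodeAt s l = some r) (hp : π <+: l) : ∃ σ a, t.nodeAt s π = some (σ, a) := by
  obtain ⟨ρ, rfl⟩ := hp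
  rw [nodeAt_append] at h
  cases hn : t.nodeAt s π with
  | none => simp [hn] at h
  | some r => exact ⟨r.1, r.2, rfl⟩

/-- Multiplying the sign of the root multiplies the signs of all nodes. -/
theorem nodeAt_mul_sign (δ s : ℤˣ) (t : LETerm S) (π : List ℕ) :
    t.nodeAt (δ * s) π = (t.nodeAt s π).map fun r => (δ * r.1, r.2) := by
  induction π generalizing s t with
  | nil => simp [nodeAt]
  | cons i π ih =>
    simp only [nodeAt]
    cases t.child i with
    | none => simp
    | some r => simp [← ih, mul_assoc]

theorem occurs_of_nodeAt {s σ : ℤˣ} {t : LETerm S} {l : List ℕ} {p : ℕ}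
    (h : t.nodeAt s l = some (σ, .var p)) : t.Occurs p := by
  refine ⟨l, s * σ, ?_⟩
  have := nodeAt_mul_sign s s t l
  rw [Int.units_mul_self, h] at this
  exact this

theorem Occurs.exists_nodeAt {t : LETerm S} {p : ℕ} (h : t.Occurs p) (s : ℤˣ) :
    ∃ l σ, t.nodeAt s l = some (σ, .var p) := by
  obtain ⟨l, σ, h⟩ := h
  refine ⟨l, s * σ, ?_⟩
  have := nodeAt_mul_sign s 1 t l
  rw [mul_one, h] at this
  exact this

@[simp] theorem nodeAt_nil (s : ℤˣ) (t : LETerm S) : t.nodeAt s [] = some (s, t) := rfl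

@[simp] theorem nodeAt_app_cons (s : ℤˣ) (h : S.Conn) (args : Fin (S.arity h) → LETerm S)
    (i : Fin (S.arity h)) (π : List ℕ) :
    (app h args).nodeAt s (i.val :: π) = (args i).nodeAt (s * S.ord h i) π := by
  simp [nodeAt, child]

theorem exists_of_nodeAt_app_cons {s : ℤˣ} {h : S.Conn} {args : Fin (S.arity h) → LETerm S}
    {n : ℕ} {π : List ℕ} {r : ℤˣ × LETerm S} (H : (app h args).nodeAt s (n :: π) = some r) :
    ∃ i : Fin (S.arity h), n = i.val ∧ (args i).nodeAt (s * S.ord h i) π = some r := by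
  by_cases hn : n < S.arity h
  · exact ⟨⟨n, hn⟩, rfl, by rwa [← nodeAt_app_cons s h args ⟨n, hn⟩]⟩
  · simp [nodeAt, child, hn] at H

@[simp] theorem nodeAt_meet_zero (s : ℤˣ) (a b : LETerm S) (π : List ℕ) :
    (meet a b).nodeAt s (0 :: π) = a.nodeAt s π := by
  simp [nodeAt, child]

@[simp] theorem nodeAt_meet_one (s : ℤˣ) (a b : LETerm S) (π : List ℕ) :
    (meet a b).nodeAt s (1 :: π) = b.nodeAt s π := by
  simp [nodeAt, child]

@[simp] theorem nodeAt_join_zero (s : ℤˣ) (a b : LETerm S) (π : List ℕ) :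
    (join a b).nodeAt s (0 :: π) = a.nodeAt s π := by
  simp [nodeAt, child]

@[simp] theorem nodeAt_join_one (s : ℤˣ) (a b : LETerm S) (π : List ℕ) :
    (join a b).nodeAt s (1 :: π) = b.nodeAt s π := by
  simp [nodeAt, child]

theorem cases_of_nodeAt_meet_cons {s : ℤˣ} {a b : LETerm S} {n : ℕ} {π : List ℕ}
    {r : ℤˣ × LETerm S} (H : (meet a b).nodeAt s (n :: π) = some r) :
    n = 0 ∧ a.nodeAt s π = some r ∨ n = 1 ∧ b.nodeAt s π = some r := by
  rcases n with _ | _ | n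
  · simpa using H
  · simpa using H
  · simp [nodeAt, child] at H

theorem cases_of_nodeAt_join_cons {s : ℤˣ} {a b : LETerm S} {n : ℕ} {π : List ℕ}
    {r : ℤˣ × LETerm S} (H : (join a b).nodeAt s (n :: π) = some r) :
    n = 0 ∧ a.nodeAt s π = some r ∨ n = 1 ∧ b.nodeAt s π = some r := by
  rcases n with _ | _ | n
  · simpa using H
  · simpa using H
  · simp [nodeAt, child] at H

@[simp] theorem nodeAt_var_cons (s : ℤˣ) (p n : ℕ) (π : List ℕ) :
    (var p : LETerm S).nodeAt s (n :: π) = none := rfl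

@[simp] theorem nodeAt_bot_cons (s : ℤˣ) (n : ℕ) (π : List ℕ) :
    (bot : LETerm S).nodeAt s (n :: π) = none := rfl

@[simp] theorem nodeAt_top_cons (s : ℤˣ) (n : ℕ) (π : List ℕ) :
    (top : LETerm S).nodeAt s (n :: π) = none := rfl

/-- Leaves have no proper descendants. -/
theorem eq_of_prefix_of_nodeAt_var {s σ : ℤˣ} {t : LETerm S} {l l' : List ℕ} {p : ℕ}
    {r : ℤˣ × LETerm S} (hl : t.nodeAt s l = some (σ, .var p)) (hl' : t.nodeAt s l' = some r)
    (h : l <+: l') : l = l' := by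
  obtain ⟨ρ, rfl⟩ := h
  rw [nodeAt_append_of hl] at hl'
  cases ρ with
  | nil => simp
  | cons => simp at hl'

theorem finite_nodes (s : ℤˣ) (t : LETerm S) : {π | (t.nodeAt s π).isSome}.Finite := by
  induction t generalizing s with
  | var p =>
    refine (Set.finite_singleton []).subset fun π hπ => ?_
    cases π <;> simp_all
  | bot =>
    refine (Set.finite_singleton []).subset fun π hπ => ?_
    cases π <;> simp_all
  | top =>
    refine (Set.finite_singleton []).subset fun π hπ => ?_
    cases π <;> simp_all
  | meet a b iha ihb =>
    refine (((iha s).image (0 :: ·)).union ((ihb s).image (1 :: ·)) |>.insert []).subset ?_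
    rintro (_ | ⟨n, π⟩) hπ
    · simp
    · obtain ⟨r, hr⟩ := Option.isSome_iff_exists.mp hπ
      rcases cases_of_nodeAt_meet_cons hr with ⟨rfl, h⟩ | ⟨rfl, h⟩ <;> simp [h]
  | join a b iha ihb =>
    refine (((iha s).image (0 :: ·)).union ((ihb s).image (1 :: ·)) |>.insert []).subset ?_
    rintro (_ | ⟨n, π⟩) hπ
    · simp
    · obtain ⟨r, hr⟩ := Option.isSome_iff_exists.mp hπ
      rcases cases_of_nodeAt_join_cons hr with ⟨rfl, h⟩ | ⟨rfl, h⟩ <;> simp [h]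
  | app h args ih =>
    refine ((Set.finite_iUnion fun i =>
      (ih i (s * S.ord h i)).image (i.val :: ·)).insert []).subset ?_
    rintro (_ | ⟨n, π⟩) hπ
    · simp
    · obtain ⟨r, hr⟩ := Option.isSome_iff_exists.mp hπ
      obtain ⟨i, rfl, h⟩ := exists_of_nodeAt_app_cons hr
      exact Or.inr (Set.mem_iUnion.mpr ⟨i, π, by simp [h], rfl⟩)

/-! ### Structural description of refined inductive trees -/

/-- No leaf of the signed generation tree is `ε`-critical. -/
def NoCritical (ε : ℕ → ℤˣ) (s : ℤˣ) (t : LETerm S) : Prop := ∀ l p, ¬ t.IsCritical ε s l p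

/-- The tree has exactly one critical leaf, labelled with `p`; its branch consists of definite PIA
nodes, and all other variables in the tree are below `p`. -/
inductive PIATree (Ω : ℕ → ℕ → Prop) (ε : ℕ → ℤˣ) (p : ℕ) : ℤˣ → LETerm S → Prop
  | leaf : PIATree Ω ε p (ε p) (.var p)
  | app (h : S.Conn) (args : Fin (S.arity h) → LETerm S) (i : Fin (S.arity h))
      (side : ∀ j, j ≠ i → (args j).NoCritical ε (-S.fam h * S.ord h j))
      (scope : ∀ q, (LETerm.app h args).Occurs q → q ≠ p → Ω q p)
      (main : PIATree Ω ε p (-S.fam h * S.ord h i) (args i)) :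
      PIATree Ω ε p (-S.fam h) (.app h args)

/-- The critical branches of the tree consist of `+∧` and `-∨` nodes, followed by PIA branches. -/
inductive MeetPIATree (Ω : ℕ → ℕ → Prop) (ε : ℕ → ℤˣ) : ℤˣ → LETerm S → Prop
  | pia (p : ℕ) {s : ℤˣ} {t : LETerm S} : PIATree Ω ε p s t → MeetPIATree Ω ε s t
  | noCritical {s : ℤˣ} {t : LETerm S} : t.NoCritical ε s → MeetPIATree Ω ε s t
  | meet {a b : LETerm S} : MeetPIATree Ω ε 1 a → MeetPIATree Ω ε 1 b →
      MeetPIATree Ω ε 1 (.meet a b)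
  | join {a b : LETerm S} : MeetPIATree Ω ε (-1) a → MeetPIATree Ω ε (-1) b →
      MeetPIATree Ω ε (-1) (.join a b)

/-- The critical branches of the tree consist of definite skeleton nodes, followed by branches as
in `MeetPIATree`. -/
inductive SkeletonTree (Ω : ℕ → ℕ → Prop) (ε : ℕ → ℤˣ) : ℤˣ → LETerm S → Prop
  | meetPIA {s : ℤˣ} {t : LETerm S} : MeetPIATree Ω ε s t → SkeletonTree Ω ε s t
  | app (h : S.Conn) (args : Fin (S.arity h) → LETerm S) :
      (∀ i, SkeletonTree Ω ε (S.fam h * S.ord h i) (args i)) →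
      SkeletonTree Ω ε (S.fam h) (.app h args)

/-- The second clause in the definition of refined inductive trees. -/
def ScopeCondition (Ω : ℕ → ℕ → Prop) (ε : ℕ → ℤˣ) (s : ℤˣ) (t : LETerm S) : Prop :=
  ∀ (l π : List ℕ) (p : ℕ) (h : S.Conn) (args : Fin (S.arity h) → LETerm S),
    t.IsCritical ε s l p → π <+: l → t.nodeAt s π = some (-S.fam h, .app h args) →
      (∀ l' p', t.IsCritical ε s l' p' → π <+: l' → l' = l) ∧
      (∀ q, (LETerm.app h args).Occurs q → q ≠ p → Ω q p)

variable {Ω : ℕ → ℕ → Prop} {ε : ℕ → ℤˣ}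

theorem NoCritical.scopeCondition {s : ℤˣ} {t : LETerm S} (h : t.NoCritical ε s) :
    t.ScopeCondition Ω ε s := fun l _ p _ _ hl => absurd hl (h l p)

theorem ScopeCondition.meet {s : ℤˣ} {a b : LETerm S} (ha : a.ScopeCondition Ω ε s)
    (hb : b.ScopeCondition Ω ε s) : (meet a b).ScopeCondition Ω ε s := by
  rintro l (_ | ⟨n, π⟩) p h args hl hπ hn
  · simp at hn
  · obtain ⟨l, rfl⟩ : ∃ l', l = n :: l' := by obtain ⟨ρ, rfl⟩ := hπ; exact ⟨_, rfl⟩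
    have hπ' := (List.cons_prefix_cons.mp hπ).2
    unfold IsCritical at hl
    have key : ∀ c : LETerm S, (∀ π, (LETerm.meet a b).nodeAt s (n :: π) = c.nodeAt s π) →
        c.ScopeCondition Ω ε s → (∀ l' p', (LETerm.meet a b).IsCritical ε s l' p' →
          n :: π <+: l' → l' = n :: l) ∧
      (∀ q, (LETerm.app h args).Occurs q → q ≠ p → Ω q p) := by
      intro c hc hcs
      rw [hc] at hl hn
      obtain ⟨h1, h2⟩ := hcs l π p h args hl hπ' hn
      refine ⟨fun l' p' hl' hp => ?_, h2⟩
      obtain ⟨l', rfl⟩ : ∃ l'', l' = n :: l'' := by obtain ⟨ρ, rfl⟩ := hp; exact ⟨_, rfl⟩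
      unfold IsCritical at hl'
      rw [hc] at hl'
      rw [h1 l' p' hl' (List.cons_prefix_cons.mp hp).2]
    rcases cases_of_nodeAt_meet_cons hl with ⟨rfl, -⟩ | ⟨rfl, -⟩
    · exact key a (by simp) ha
    · exact key b (by simp) hb

theorem ScopeCondition.join {s : ℤˣ} {a b : LETerm S} (ha : a.ScopeCondition Ω ε s)
    (hb : b.ScopeCondition Ω ε s) : (join a b).ScopeCondition Ω ε s := by
  rintro l (_ | ⟨n, π⟩) p h args hl hπ hn
  · simp at hn
  · obtain ⟨l, rfl⟩ : ∃ l', l = n :: l' := by obtain ⟨ρ, rfl⟩ := hπ; exact ⟨_, rfl⟩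
    have hπ' := (List.cons_prefix_cons.mp hπ).2
    unfold IsCritical at hl
    have key : ∀ c : LETerm S, (∀ π, (LETerm.join a b).nodeAt s (n :: π) = c.nodeAt s π) →
        c.ScopeCondition Ω ε s → (∀ l' p', (LETerm.join a b).IsCritical ε s l' p' →
          n :: π <+: l' → l' = n :: l) ∧
      (∀ q, (LETerm.app h args).Occurs q → q ≠ p → Ω q p) := by
      intro c hc hcs
      rw [hc] at hl hn
      obtain ⟨h1, h2⟩ := hcs l π p h args hl hπ' hn
      refine ⟨fun l' p' hl' hp => ?_, h2⟩
      obtain ⟨l', rfl⟩ : ∃ l'', l' = n :: l'' := by obtain ⟨ρ, rfl⟩ := hp; exact ⟨_, rfl⟩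
      unfold IsCritical at hl'
      rw [hc] at hl'
      rw [h1 l' p' hl' (List.cons_prefix_cons.mp hp).2]
    rcases cases_of_nodeAt_join_cons hl with ⟨rfl, -⟩ | ⟨rfl, -⟩
    · exact key a (by simp) ha
    · exact key b (by simp) hb

/-- The scope condition passes from the immediate subtrees to the tree, when it holds at the
root. -/
theorem ScopeCondition.app {s : ℤˣ} {h : S.Conn} {args : Fin (S.arity h) → LETerm S}
    (hargs : ∀ i, (args i).ScopeCondition Ω ε (s * S.ord h i))
    (hroot : s = -S.fam h → ∀ l p, (app h args).IsCritical ε s l p →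
      (∀ l' p', (LETerm.app h args).IsCritical ε s l' p' → l' = l) ∧
      (∀ q, (LETerm.app h args).Occurs q → q ≠ p → Ω q p)) :
    (app h args).ScopeCondition Ω ε s := by
  rintro l (_ | ⟨n, π⟩) p h' args' hl hπ hn
  · simp only [nodeAt_nil, Option.some.injEq, Prod.mk.injEq, app.injEq] at hn
    obtain ⟨rfl, rfl, h3⟩ := hn
    obtain rfl := eq_of_heq h3
    obtain ⟨h1, h2⟩ := hroot rfl l p hl
    exact ⟨fun l' p' hl' _ => h1 l' p' hl', h2⟩
  · obtain ⟨l, rfl⟩ : ∃ l', l = n :: l' := by obtain ⟨ρ, rfl⟩ := hπ; exact ⟨_, rfl⟩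
    have hπ' := (List.cons_prefix_cons.mp hπ).2
    obtain ⟨i, rfl, hli⟩ := exists_of_nodeAt_app_cons hl
    rw [nodeAt_app_cons] at hn
    obtain ⟨h1, h2⟩ := hargs i l π p h' args' hli hπ' hn
    refine ⟨fun l' p' hl' hp => ?_, h2⟩
    obtain ⟨l', rfl⟩ : ∃ l'', l' = i.val :: l'' := by obtain ⟨ρ, rfl⟩ := hp; exact ⟨_, rfl⟩
    unfold IsCritical at hl'
    rw [nodeAt_app_cons] at hl'
    rw [h1 l' p' hl' (List.cons_prefix_cons.mp hp).2]

/-- The branch of the critical leaf in a `PIATree`. -/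
theorem PIATree.exists_branch {p : ℕ} {s : ℤˣ} {t : LETerm S} (h : t.PIATree Ω ε p s) :
    ∃ l, (∀ l' p', t.IsCritical ε s l' p' → l' = l ∧ p' = p) ∧
      ∀ k < l.length, t.IsDefPIA s (l.take k) := by
  induction h with
  | leaf =>
    refine ⟨[], ?_, by simp⟩
    rintro (_ | ⟨n, l'⟩) p' hl'
    · simp [IsCritical] at hl'
      exact ⟨rfl, hl'.2.symm⟩
    · simp [IsCritical] at hl'
  | app h args i side scope main ih =>
    obtain ⟨l, h1, h2⟩ := ih
    refine ⟨i.val :: l, ?_, ?_⟩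
    · rintro (_ | ⟨n, l'⟩) p' hl'
      · simp [IsCritical] at hl'
      · obtain ⟨j, rfl, hlj⟩ := exists_of_nodeAt_app_cons hl'
        by_cases hj : j = i
        · subst hj
          obtain ⟨rfl, rfl⟩ := h1 l' p' hlj
          simp
        · exact absurd hlj (side j hj l' p')
    · rintro (_ | k) hk
      · exact ⟨h, args, rfl⟩
      · obtain ⟨h', args', hn⟩ := h2 k (by simpa using hk)
        exact ⟨h', args', by simpa using hn⟩

theorem PIATree.scopeCondition {p : ℕ} {s : ℤˣ} {t : LETerm S} (h : t.PIATree Ω ε p s) :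
    t.ScopeCondition Ω ε s := by
  induction h with
  | leaf =>
    intro l π p' h args hl hπ hn
    cases π <;> simp at hn
  | app h args i side scope main ih =>
    refine ScopeCondition.app (fun j => ?_) fun _ l p' hl => ?_
    · by_cases hj : j = i
      · subst hj; exact ih
      · exact (side j hj).scopeCondition
    · obtain ⟨l₀, h1, -⟩ := (PIATree.app h args i side scope main).exists_branch
      obtain ⟨rfl, rfl⟩ := h1 l p' hl
      exact ⟨fun l' p'' hl' => (h1 l' p'' hl').1, scope⟩

theorem MeetPIATree.scopeCondition {s : ℤˣ} {t : LETerm S} (h : t.MeetPIATree Ω ε s) :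
    t.ScopeCondition Ω ε s := by
  induction h with
  | pia p h => exact h.scopeCondition
  | noCritical h => exact h.scopeCondition
  | meet _ _ iha ihb => exact iha.meet ihb
  | join _ _ iha ihb => exact iha.join ihb

theorem SkeletonTree.scopeCondition {s : ℤˣ} {t : LETerm S} (h : t.SkeletonTree Ω ε s) :
    t.ScopeCondition Ω ε s := by
  induction h with
  | meetPIA h => exact h.scopeCondition
  | app h args _ ih =>
    refine ScopeCondition.app ih fun hs => ?_
    rcases Int.units_eq_one_or (S.fam h) with e | e <;> rw [e] at hs <;> exact absurd hs (by decide)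

theorem MeetPIATree.exists_bound {s : ℤˣ} {t : LETerm S} (h : t.MeetPIATree Ω ε s) :
    ∀ l p, t.IsCritical ε s l p → ∃ b : ℕ, ∀ k < l.length,
      (k < b → t.IsPlusMeetOrMinusJoin s (l.take k)) ∧ (b ≤ k → t.IsDefPIA s (l.take k)) := by
  induction h with
  | pia p h =>
    intro l p' hl
    obtain ⟨l₀, h1, h2⟩ := h.exists_branch
    obtain ⟨rfl, rfl⟩ := h1 l p' hl
    exact ⟨0, fun k hk => ⟨by simp, fun _ => h2 k hk⟩⟩
  | noCritical h => exact fun l p hl => absurd hl (h l p)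
  | @meet a b _ _ iha ihb =>
    rintro (_ | ⟨n, l⟩) p hl
    · simp [IsCritical] at hl
    · have key : ∀ c : LETerm S, (∀ π, (LETerm.meet a b).nodeAt 1 (n :: π) = c.nodeAt 1 π) →
          (∃ b : ℕ, ∀ k < l.length, (k < b → c.IsPlusMeetOrMinusJoin 1 (l.take k)) ∧
            (b ≤ k → c.IsDefPIA 1 (l.take k))) → ∃ b' : ℕ, ∀ k < (n :: l).length,
          (k < b' → (LETerm.meet a b).IsPlusMeetOrMinusJoin 1 ((n :: l).take k)) ∧
            (b' ≤ k → (LETerm.meet a b).IsDefPIA 1 ((n :: l).take k)) := by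
        rintro c hc ⟨b', hb'⟩
        refine ⟨b' + 1, ?_⟩
        rintro (_ | k) hk
        · exact ⟨fun _ => ⟨a, b, Or.inl rfl⟩, by simp⟩
        · have := hb' k (by simpa using hk)
          simpa [IsPlusMeetOrMinusJoin, IsDefPIA, hc] using this
      rcases cases_of_nodeAt_meet_cons hl with ⟨rfl, hl⟩ | ⟨rfl, hl⟩
      · exact key a (by simp) (iha l p hl)
      · exact key b (by simp) (ihb l p hl)
  | @join a b _ _ iha ihb =>
    rintro (_ | ⟨n, l⟩) p hl
    · simp [IsCritical] at hl
    · have key : ∀ c : LETerm S, (∀ π, (LETerm.join a b).nodeAt (-1) (n :: π) = c.nodeAt (-1) π) →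
          (∃ b : ℕ, ∀ k < l.length, (k < b → c.IsPlusMeetOrMinusJoin (-1) (l.take k)) ∧
            (b ≤ k → c.IsDefPIA (-1) (l.take k))) → ∃ b' : ℕ, ∀ k < (n :: l).length,
          (k < b' → (LETerm.join a b).IsPlusMeetOrMinusJoin (-1) ((n :: l).take k)) ∧
            (b' ≤ k → (LETerm.join a b).IsDefPIA (-1) ((n :: l).take k)) := by
        rintro c hc ⟨b', hb'⟩
        refine ⟨b' + 1, ?_⟩
        rintro (_ | k) hk
        · exact ⟨fun _ => ⟨a, b, Or.inr rfl⟩, by simp⟩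
        · have := hb' k (by simpa using hk)
          simpa [IsPlusMeetOrMinusJoin, IsDefPIA, hc] using this
      rcases cases_of_nodeAt_join_cons hl with ⟨rfl, hl⟩ | ⟨rfl, hl⟩
      · exact key a (by simp) (iha l p hl)
      · exact key b (by simp) (ihb l p hl)

theorem SkeletonTree.isRefinedGood {s : ℤˣ} {t : LETerm S} (h : t.SkeletonTree Ω ε s) :
    ∀ l p, t.IsCritical ε s l p → t.IsRefinedGood s l := by
  induction h with
  | meetPIA h =>
    intro l p hl
    obtain ⟨b, hb⟩ := h.exists_bound l p hl
    exact ⟨0, b, fun k hk => ⟨by simp, fun _ => (hb k hk).1, fun _ => (hb k hk).2⟩⟩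
  | app h args _ ih =>
    rintro (_ | ⟨n, l⟩) p hl
    · simp [IsCritical] at hl
    · obtain ⟨i, rfl, hli⟩ := exists_of_nodeAt_app_cons hl
      obtain ⟨a, b, hab⟩ := ih i l p hli
      refine ⟨a + 1, b + 1, ?_⟩
      rintro (_ | k) hk
      · exact ⟨fun _ => ⟨h, args, rfl⟩, by simp, by simp⟩
      · have := hab k (by simpa using hk)
        simpa [IsDefSkeleton, IsPlusMeetOrMinusJoin, IsDefPIA] using this

theorem SkeletonTree.isRefinedInductiveTree {s : ℤˣ} {t : LETerm S} (h : t.SkeletonTree Ω ε s) :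
    t.IsRefinedInductiveTree Ω ε s :=
  ⟨h.isRefinedGood, fun l π p c args hl hπ hn _ => h.scopeCondition l π p c args hl hπ hn⟩

/-! ### Monotonicity in the variables and uniform variables -/

variable {L : LELang.{u}} {A : Type v} [CompleteLattice A] (M : PerfectLE L A)

theorem signedLE_inf {s : ℤˣ} {a b c d : A} (h : signedLE s a c) (h' : signedLE s b d) :
    signedLE s (a ⊓ b) (c ⊓ d) := by
  unfold signedLE at *
  split_ifs at * <;> exact inf_le_inf h h'

theorem signedLE_sup {s : ℤˣ} {a b c d : A} (h : signedLE s a c) (h' : signedLE s b d) :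
    signedLE s (a ⊔ b) (c ⊔ d) := by
  unfold signedLE at *
  split_ifs at * <;> exact sup_le_sup h h'

theorem eval_signedLE (t : LETerm L.toLESig) (s : ℤˣ) (v w : ℕ → A)
    (h : ∀ l σ p, t.nodeAt s l = some (σ, .var p) → signedLE σ (v p) (w p)) :
    signedLE s (t.eval M.op v) (t.eval M.op w) := by
  induction t generalizing s with
  | var p => exact h [] s p rfl
  | bot => exact signedLE_refl _ _
  | top => exact signedLE_refl _ _
  | meet a b iha ihb =>
    exact signedLE_inf (iha s fun l σ p hl => h (0 :: l) σ p (by simpa using hl))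
      (ihb s fun l σ p hl => h (1 :: l) σ p (by simpa using hl))
  | join a b iha ihb =>
    exact signedLE_sup (iha s fun l σ p hl => h (0 :: l) σ p (by simpa using hl))
      (ihb s fun l σ p hl => h (1 :: l) σ p (by simpa using hl))
  | app c args ih =>
    exact M.op_mono c s fun i => ih i _ fun l σ p hl =>
      h (i.val :: l) σ p (by rw [nodeAt_app_cons]; exact hl)

/-- Uniform substitution of terms for variables. -/
def subst (θ : ℕ → LETerm S) : LETerm S → LETerm S
  | .var p => θ p
  | .bot => .bot
  | .top => .top
  | .meet a b => .meet (a.subst θ) (b.subst θ)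
  | .join a b => .join (a.subst θ) (b.subst θ)
  | .app h args => .app h fun i => (args i).subst θ

theorem eval_subst (θ : ℕ → LETerm L.toLESig) (v : ℕ → A) (t : LETerm L.toLESig) :
    (t.subst θ).eval M.op v = t.eval M.op fun p => (θ p).eval M.op v := by
  induction t with
  | var p => rfl
  | bot => rfl
  | top => rfl
  | meet a b iha ihb => simp [subst, eval, iha, ihb]
  | join a b iha ihb => simp [subst, eval, iha, ihb]
  | app h args ih => simp [subst, eval, ih]

/-- A substitution that leaves each variable alone or replaces it by a constant. -/
def IsConstSubst (θ : ℕ → LETerm S) : Prop := ∀ p, θ p = .var p ∨ θ p = .bot ∨ θ p = .top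

theorem nodeAt_subst {θ : ℕ → LETerm S} (hθ : IsConstSubst θ) (s : ℤˣ) (t : LETerm S)
    (π : List ℕ) :
    (t.subst θ).nodeAt s π = (t.nodeAt s π).map fun r => (r.1, r.2.subst θ) := by
  induction π generalizing s t with
  | nil => simp
  | cons n π ih =>
    cases t with
    | var p => rcases hθ p with h | h | h <;> simp [subst, h]
    | bot => simp [subst]
    | top => simp [subst]
    | meet a b => rcases n with _ | _ | n <;> simp [subst, nodeAt, child, ih]
    | join a b => rcases n with _ | _ | n <;> simp [subst, nodeAt, child, ih]
    | app h args =>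
      by_cases hn : n < S.arity h
      · simp [subst, nodeAt, child, hn, ih]
      · simp [subst, nodeAt, child, hn]

theorem nodeAt_of_subst_var {θ : ℕ → LETerm S} (hθ : IsConstSubst θ) {s : ℤˣ} {t : LETerm S}
    {π : List ℕ} {σ : ℤˣ} {p : ℕ} (h : (t.subst θ).nodeAt s π = some (σ, .var p)) :
    t.nodeAt s π = some (σ, .var p) ∧ θ p = .var p := by
  rw [nodeAt_subst hθ, Option.map_eq_some_iff] at h
  obtain ⟨⟨σ', u⟩, h1, h2⟩ := h
  simp only [Prod.mk.injEq] at h2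
  obtain ⟨rfl, h2⟩ := h2
  cases u with
  | var q =>
    rcases hθ q with h | h | h <;> simp only [subst, h, reduceCtorEq, var.injEq] at h2
    subst h2
    exact ⟨h1, h⟩
  | _ => simp [subst] at h2

theorem IsRefinedInductiveTree.subst {θ : ℕ → LETerm S} (hθ : IsConstSubst θ) {s : ℤˣ}
    {t : LETerm S} (h : t.IsRefinedInductiveTree Ω ε s) :
    (t.subst θ).IsRefinedInductiveTree Ω ε s := by
  constructor
  · intro l p hl
    obtain ⟨a, b, hab⟩ := h.1 l p (nodeAt_of_subst_var hθ hl).1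
    refine ⟨a, b, fun k hk => ?_⟩
    obtain ⟨h1, h2, h3⟩ := hab k hk
    refine ⟨fun ha => ?_, fun ha hb => ?_, fun ha hb => ?_⟩
    · obtain ⟨c, args, hn⟩ := h1 ha
      exact ⟨c, _, by rw [nodeAt_subst hθ, hn]; rfl⟩
    · obtain ⟨x, y, hn⟩ := h2 ha hb
      refine ⟨x.subst θ, y.subst θ, ?_⟩
      rcases hn with hn | hn
      · exact Or.inl (by rw [nodeAt_subst hθ, hn]; rfl)
      · exact Or.inr (by rw [nodeAt_subst hθ, hn]; rfl)
    · obtain ⟨c, args, hn⟩ := h3 ha hb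
      exact ⟨c, _, by rw [nodeAt_subst hθ, hn]; rfl⟩
  · intro l π p c args hl hπ hn har
    rw [nodeAt_subst hθ, Option.map_eq_some_iff] at hn
    obtain ⟨⟨σ, u⟩, h1, h2⟩ := hn
    simp only [Prod.mk.injEq] at h2
    obtain ⟨rfl, h2⟩ := h2
    cases u with
    | app c' args' =>
      simp only [LETerm.subst, app.injEq] at h2
      obtain ⟨rfl, h2⟩ := h2
      obtain rfl := eq_of_heq h2
      obtain ⟨h3, h4⟩ := h.2 l π p c' args' (nodeAt_of_subst_var hθ hl).1 hπ h1 har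
      refine ⟨fun l' p' hl' => h3 l' p' (nodeAt_of_subst_var hθ hl').1, fun q hq => h4 q ?_⟩
      obtain ⟨l', σ', hq⟩ := hq
      exact ⟨l', σ', (nodeAt_of_subst_var hθ (t := .app c' args') hq).1⟩
    | var q =>
      rcases hθ q with h | h | h <;> simp [LETerm.subst, h] at h2
    | _ => simp [LETerm.subst] at h2

end LETerm

open LETerm in
/-- Variables that occur uniformly can be eliminated: since the inequality is monotone or antitone
in such a variable, its validity only depends on the instance `⊤` or `⊥`. -/
theorem exists_isRefinedInductive {L : LELang.{u}} {Ω : ℕ → ℕ → Prop} {ε : ℕ → ℤˣ}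
    {s t : LETerm L.toLESig} (h : IsRefinedInductiveFor Ω ε s t) :
    ∃ s' t' : LETerm L.toLESig, IsRefinedInductive Ω ε s' t' ∧
      ∀ (A : Type v) [CompleteLattice A] (M : PerfectLE L A), M.Valid s t ↔ M.Valid s' t' := by
  classical
  obtain ⟨θ, hθ⟩ : ∃ θ : ℕ → LETerm L.toLESig, θ = fun p =>
      if OccursSigned s t p 1 then if OccursSigned s t p (-1) then .var p else .top else .bot :=
    ⟨_, rfl⟩
  have hc : IsConstSubst θ := by
    intro p
    rw [hθ]
    dsimp only
    split_ifs <;> simp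
  have hvar : ∀ p, θ p = .var p → ∀ σ, OccursSigned s t p σ := by
    intro p hp σ
    rw [hθ] at hp
    dsimp only at hp
    split_ifs at hp with h1 h2
    rcases Int.units_eq_one_or σ with rfl | rfl
    · exact h1
    · exact h2
  refine ⟨s.subst θ, t.subst θ, ⟨⟨h.1, h.2.1.subst hc, h.2.2.subst hc⟩, ?_⟩, ?_⟩
  · have hocc : ∀ p σ, θ p = .var p → OccursSigned s t p σ →
        OccursSigned (s.subst θ) (t.subst θ) p σ := by
      rintro p σ hp (⟨l, hl⟩ | ⟨l, hl⟩)
      · exact Or.inl ⟨l, by rw [nodeAt_subst hc, hl]; simp [LETerm.subst, hp]⟩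
      · exact Or.inr ⟨l, by rw [nodeAt_subst hc, hl]; simp [LETerm.subst, hp]⟩
    have hθp : ∀ p σ, OccursSigned (s.subst θ) (t.subst θ) p σ → θ p = .var p := by
      rintro p σ (⟨l, hl⟩ | ⟨l, hl⟩) <;> exact (nodeAt_of_subst_var hc hl).2
    exact fun p σ hp => hocc p (-σ) (hθp p σ hp) (hvar p (hθp p σ hp) _)
  · intro A _ M
    constructor
    · intro hv val
      rw [eval_subst, eval_subst]
      exact hv _
    · intro hv val
      have key : ∀ p σ, OccursSigned s t p σ → signedLE σ (val p) ((θ p).eval M.op val) := by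
        intro p σ hp
        rw [hθ]
        rcases Int.units_eq_one_or σ with rfl | rfl
        · by_cases h2 : OccursSigned s t p (-1) <;> simp [hp, h2, signedLE, eval]
        · by_cases h2 : OccursSigned s t p 1 <;> simp [hp, h2, signedLE, eval]
      have h1 := eval_signedLE M s 1 val (fun p => (θ p).eval M.op val)
        fun l σ p hl => key p σ (Or.inl ⟨l, hl⟩)
      have h2 := eval_signedLE M t (-1) val (fun p => (θ p).eval M.op val)
        fun l σ p hl => key p σ (Or.inr ⟨l, hl⟩)
      rw [signedLE_neg] at h2
      have h3 := hv val
      rw [eval_subst, eval_subst] at h3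
      simp only [signedLE, if_true] at h1 h2
      exact h1.trans (h3.trans h2)

/-! ### Extraction of marked subtrees -/

namespace LETerm

variable {L : LELang.{u}} {Ω : ℕ → ℕ → Prop} {ε : ℕ → ℤˣ}

theorem nodeAt_star_app_cons (s : ℤˣ) (c : StarConn L) (args : Fin c.arity → LETerm L.star)
    (i : Fin c.arity) (π : List ℕ) :
    (app (S := L.star) c args).nodeAt s (i.val :: π) = (args i).nodeAt (s * c.ord i) π :=
  nodeAt_app_cons (S := L.star) s c args i π

/-- The variable `x` if the node is marked with `x`, and `u` if it is not marked. -/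
def markOr {S : LESig.{u}} (o : Option ℕ) (u : LETerm S) : LETerm S :=
  match o with
  | some x => .var x
  | none => u

/-- A marking `m` assigns variables to some nodes. `extract C t m` replaces each topmost marked
subtree of `t` by the variable of its root, and each remaining variable `p` by `C p`. A subtree whose
root carries a connective outside `L`, with no mark at or above it, becomes the dummy value `⊥`. -/
def extract (C : ℕ → LETerm L.toLESig) :
    LETerm L.star → (List ℕ → Option ℕ) → LETerm L.toLESig
  | .var p, m => markOr (m []) (C p)
  | .bot, m => markOr (m []) .bot
  | .top, m => markOr (m []) .top
  | .meet a b, m => markOr (m [])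
      (.meet (extract C a fun π => m (0 :: π)) (extract C b fun π => m (1 :: π)))
  | .join a b, m => markOr (m [])
      (.join (extract C a fun π => m (0 :: π)) (extract C b fun π => m (1 :: π)))
  | .app (.base h) args, m => markOr (m [])
      (.app h fun i => extract C (args i) fun π => m (i.val :: π))
  | .app (.res _ _) _, m => markOr (m []) .bot

/-- All connectives outside `L` and all non-critical leaves of the tree lie in marked subtrees. -/
inductive Extractable (ε : ℕ → ℤˣ) : (List ℕ → Option ℕ) → ℤˣ → LETerm L.star → Prop
  | marked {m s t} (x : ℕ) : m [] = some x → Extractable ε m s t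
  | critical {m} (p : ℕ) : m [] = none → Extractable ε m (ε p) (.var p)
  | bot {m s} : m [] = none → Extractable ε m s .bot
  | top {m s} : m [] = none → Extractable ε m s .top
  | meet {m s a b} : m [] = none → Extractable ε (fun π => m (0 :: π)) s a →
      Extractable ε (fun π => m (1 :: π)) s b → Extractable ε m s (.meet a b)
  | join {m s a b} : m [] = none → Extractable ε (fun π => m (0 :: π)) s a →
      Extractable ε (fun π => m (1 :: π)) s b → Extractable ε m s (.join a b)
  | app {m s} (h : L.Conn) (args : Fin (L.arity h) → LETerm L.star) : m [] = none →
      (∀ i, Extractable ε (fun π => m (i.val :: π)) (s * L.ord h i) (args i)) →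
      Extractable ε m s (.app (S := L.star) (.base h) args)

theorem extract_of_marked {C : ℕ → LETerm L.toLESig} {t : LETerm L.star}
    {m : List ℕ → Option ℕ} {x : ℕ} (h : m [] = some x) : extract C t m = .var x := by
  cases t with
  | app c args => cases c <;> simp [extract, h, markOr]
  | _ => simp [extract, h, markOr]

theorem extractable_of_forall_exists_marked {m : List ℕ → Option ℕ} {s : ℤˣ} {t : LETerm L.star}
    (hleaf : ∀ l σ p, t.nodeAt s l = some (σ, .var p) → σ ≠ ε p → ∃ π x, π <+: l ∧ m π = some x)
    (hconn : ∀ π σ (c : StarConn L) args, t.nodeAt s π = some (σ, .app (S := L.star) c args) →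
      ¬ c.InBase → ∃ π' x, π' <+: π ∧ m π' = some x) :
    Extractable ε m s t := by
  induction t generalizing m s with
  | var p =>
    cases hm : m [] with
    | some x => exact .marked x hm
    | none =>
      by_cases hs : s = ε p
      · subst hs; exact .critical p hm
      · obtain ⟨π, x, hπ, hx⟩ := hleaf [] s p rfl hs
        simp only [List.prefix_nil] at hπ
        simp [hπ, hm] at hx
  | bot =>
    cases hm : m [] with
    | some x => exact .marked x hm
    | none => exact .bot hm
  | top =>
    cases hm : m [] with
    | some x => exact .marked x hm
    | none => exact .top hm
  | meet a b iha ihb =>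
    cases hm : m [] with
    | some x => exact .marked x hm
    | none =>
      have key : ∀ n l, (∃ π x, π <+: n :: l ∧ m π = some x) →
          ∃ π x, π <+: l ∧ m (n :: π) = some x := by
        rintro n l ⟨_ | ⟨k, π⟩, x, hπ, hx⟩
        · simp [hm] at hx
        · obtain ⟨rfl, hπ'⟩ := List.cons_prefix_cons.mp hπ
          exact ⟨π, x, hπ', hx⟩
      exact .meet hm
        (iha (fun l σ p hl hσ => key 0 l (hleaf (0 :: l) σ p (by simpa using hl) hσ))
          fun l σ c args hl hc => key 0 l (hconn (0 :: l) σ c args (by simpa using hl) hc))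
        (ihb (fun l σ p hl hσ => key 1 l (hleaf (1 :: l) σ p (by simpa using hl) hσ))
          fun l σ c args hl hc => key 1 l (hconn (1 :: l) σ c args (by simpa using hl) hc))
  | join a b iha ihb =>
    cases hm : m [] with
    | some x => exact .marked x hm
    | none =>
      have key : ∀ n l, (∃ π x, π <+: n :: l ∧ m π = some x) →
          ∃ π x, π <+: l ∧ m (n :: π) = some x := by
        rintro n l ⟨_ | ⟨k, π⟩, x, hπ, hx⟩
        · simp [hm] at hx
        · obtain ⟨rfl, hπ'⟩ := List.cons_prefix_cons.mp hπ
          exact ⟨π, x, hπ', hx⟩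
      exact .join hm
        (iha (fun l σ p hl hσ => key 0 l (hleaf (0 :: l) σ p (by simpa using hl) hσ))
          fun l σ c args hl hc => key 0 l (hconn (0 :: l) σ c args (by simpa using hl) hc))
        (ihb (fun l σ p hl hσ => key 1 l (hleaf (1 :: l) σ p (by simpa using hl) hσ))
          fun l σ c args hl hc => key 1 l (hconn (1 :: l) σ c args (by simpa using hl) hc))
  | app c args ih =>
    cases hm : m [] with
    | some x => exact .marked x hm
    | none =>
      have key : ∀ n l, (∃ π x, π <+: n :: l ∧ m π = some x) →
          ∃ π x, π <+: l ∧ m (n :: π) = some x := by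
        rintro n l ⟨_ | ⟨k, π⟩, x, hπ, hx⟩
        · simp [hm] at hx
        · obtain ⟨rfl, hπ'⟩ := List.cons_prefix_cons.mp hπ
          exact ⟨π, x, hπ', hx⟩
      by_cases hc : StarConn.InBase (L := L) c
      · obtain ⟨h, rfl⟩ := hc
        refine .app h args hm fun i => ih i ?_ ?_
        · exact fun l σ p hl hσ => key i.val l
            (hleaf (i.val :: l) σ p ((nodeAt_star_app_cons _ (.base h) _ i _).trans hl) hσ)
        · exact fun l σ c args hl hc => key i.val l
            (hconn (i.val :: l) σ c args ((nodeAt_star_app_cons _ (.base h) _ i _).trans hl) hc)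
      · obtain ⟨π, x, hπ, hx⟩ := hconn [] s c args rfl hc
        simp only [List.prefix_nil] at hπ
        simp [hπ, hm] at hx

/-- If the values of the extracted subtrees and of the substituted critical variables approximate
the original ones (from the side given by `κ`), then so does the value of the extracted term. -/
theorem Extractable.signedLE_eval {A : Type v} [CompleteLattice A] (M : PerfectLE L A)
    {m : List ℕ → Option ℕ} {s : ℤˣ} {t : LETerm L.star} (h : Extractable ε m s t) (κ : ℤˣ)
    (C : ℕ → LETerm L.toLESig) (w v : ℕ → A)
    (hm : ∀ π x σ u, m π = some x → t.nodeAt s π = some (σ, u) →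
      signedLE (κ * σ) (w x) (u.eval (S := L.star) M.starOp v))
    (hC : ∀ l p, t.IsCritical ε s l p → signedLE (κ * ε p) ((C p).eval M.op w) (v p)) :
    signedLE (κ * s) ((extract C t m).eval M.op w) (t.eval (S := L.star) M.starOp v) := by
  induction h with
  | @marked m s t x hx =>
    rw [extract_of_marked hx]
    exact hm [] x s t hx rfl
  | critical p hp =>
    simp only [extract, hp, markOr]
    exact hC [] p rfl
  | bot hp =>
    simp only [extract, hp, markOr]
    exact signedLE_refl _ _
  | top hp =>
    simp only [extract, hp, markOr]
    exact signedLE_refl _ _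
  | meet hp _ _ iha ihb =>
    simp only [extract, hp, markOr]
    exact signedLE_inf
      (iha (fun π x σ u hx hu => hm (0 :: π) x σ u hx (by simpa using hu))
        fun l p hl => hC (0 :: l) p (by simpa [IsCritical] using hl))
      (ihb (fun π x σ u hx hu => hm (1 :: π) x σ u hx (by simpa using hu))
        fun l p hl => hC (1 :: l) p (by simpa [IsCritical] using hl))
  | join hp _ _ iha ihb =>
    simp only [extract, hp, markOr]
    exact signedLE_sup
      (iha (fun π x σ u hx hu => hm (0 :: π) x σ u hx (by simpa using hu))
        fun l p hl => hC (0 :: l) p (by simpa [IsCritical] using hl))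
      (ihb (fun π x σ u hx hu => hm (1 :: π) x σ u hx (by simpa using hu))
        fun l p hl => hC (1 :: l) p (by simpa [IsCritical] using hl))
  | @app m s h args hp _ ih =>
    simp only [extract, hp, markOr]
    refine M.op_mono h (κ * s) fun i => ?_
    rw [mul_assoc]
    exact ih i
      (fun π x σ u hx hu => hm (i.val :: π) x σ u hx
        ((nodeAt_star_app_cons _ (.base h) _ i _).trans hu))
      fun l p hl => hC (i.val :: l) p ((nodeAt_star_app_cons _ (.base h) _ i _).trans hl)

/-- The leaves of the extracted term. -/
theorem Extractable.cases_nodeAt_var {m : List ℕ → Option ℕ} {s : ℤˣ} {t : LETerm L.star}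
    (h : Extractable ε m s t) (C : ℕ → LETerm L.toLESig) {l : List ℕ} {σ : ℤˣ} {q : ℕ}
    (hl : (extract C t m).nodeAt s l = some (σ, .var q)) :
    (∃ π u, m π = some q ∧ t.nodeAt s π = some (σ, u)) ∨
      ∃ p l₀ l', t.IsCritical ε s l₀ p ∧ (C p).nodeAt (ε p) l' = some (σ, .var q) := by
  induction h generalizing l with
  | @marked m s t x hx =>
    rw [extract_of_marked hx] at hl
    cases l with
    | nil =>
      simp only [nodeAt_nil, Option.some.injEq, Prod.mk.injEq, var.injEq] at hl
      obtain ⟨rfl, rfl⟩ := hl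
      exact Or.inl ⟨[], t, hx, rfl⟩
    | cons => simp at hl
  | critical p hp =>
    simp only [extract, hp, markOr] at hl
    exact Or.inr ⟨p, [], l, rfl, hl⟩
  | bot hp =>
    simp only [extract, hp, markOr] at hl
    cases l <;> simp at hl
  | top hp =>
    simp only [extract, hp, markOr] at hl
    cases l <;> simp at hl
  | meet hp _ _ iha ihb =>
    simp only [extract, hp, markOr] at hl
    cases l with
    | nil => simp at hl
    | cons n l =>
      rcases cases_of_nodeAt_meet_cons hl with ⟨rfl, hl₁⟩ | ⟨rfl, hl₁⟩
      · rcases iha hl₁ with ⟨π, u, h1, h2⟩ | ⟨p, l₀, l', h1, h2⟩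
        · exact Or.inl ⟨0 :: π, u, h1, by simpa using h2⟩
        · exact Or.inr ⟨p, 0 :: l₀, l', by simpa [IsCritical] using h1, h2⟩
      · rcases ihb hl₁ with ⟨π, u, h1, h2⟩ | ⟨p, l₀, l', h1, h2⟩
        · exact Or.inl ⟨1 :: π, u, h1, by simpa using h2⟩
        · exact Or.inr ⟨p, 1 :: l₀, l', by simpa [IsCritical] using h1, h2⟩
  | join hp _ _ iha ihb =>
    simp only [extract, hp, markOr] at hl
    cases l with
    | nil => simp at hl
    | cons n l =>
      rcases cases_of_nodeAt_join_cons hl with ⟨rfl, hl₁⟩ | ⟨rfl, hl₁⟩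
      · rcases iha hl₁ with ⟨π, u, h1, h2⟩ | ⟨p, l₀, l', h1, h2⟩
        · exact Or.inl ⟨0 :: π, u, h1, by simpa using h2⟩
        · exact Or.inr ⟨p, 0 :: l₀, l', by simpa [IsCritical] using h1, h2⟩
      · rcases ihb hl₁ with ⟨π, u, h1, h2⟩ | ⟨p, l₀, l', h1, h2⟩
        · exact Or.inl ⟨1 :: π, u, h1, by simpa using h2⟩
        · exact Or.inr ⟨p, 1 :: l₀, l', by simpa [IsCritical] using h1, h2⟩
  | @app m s h args hp _ ih =>
    simp only [extract, hp, markOr] at hl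
    cases l with
    | nil => simp at hl
    | cons n l =>
      obtain ⟨i, rfl, hl₁⟩ := exists_of_nodeAt_app_cons hl
      rcases ih i hl₁ with ⟨π, u, h1, h2⟩ | ⟨p, l₀, l', h1, h2⟩
      · exact Or.inl ⟨i.val :: π, u, h1, (nodeAt_star_app_cons _ (.base h) _ i _).trans h2⟩
      · exact Or.inr
          ⟨p, i.val :: l₀, l', (nodeAt_star_app_cons _ (.base h) _ i _).trans h1, h2⟩

/-- The leaves of the extracted term, when there are no critical leaves or these are replaced by
the dummy value `⊥`. -/
theorem Extractable.exists_marked {m : List ℕ → Option ℕ} {s : ℤˣ} {t : LETerm L.star}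
    (h : Extractable ε m s t) {C : ℕ → LETerm L.toLESig}
    (hC : (∀ p, C p = .bot) ∨ t.NoCritical ε s) {l : List ℕ} {σ : ℤˣ} {q : ℕ}
    (hl : (extract C t m).nodeAt s l = some (σ, .var q)) :
    ∃ π u, m π = some q ∧ t.nodeAt s π = some (σ, u) := by
  rcases h.cases_nodeAt_var C hl with h | ⟨p, l₀, l', h1, h2⟩
  · exact h
  · rcases hC with hC | hC
    · rw [hC] at h2
      cases l' <;> simp at h2
    · exact absurd h1 (hC l₀ p)

theorem Extractable.noCritical {m : List ℕ → Option ℕ} {s : ℤˣ} {t : LETerm L.star}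
    (h : Extractable ε m s t) {C : ℕ → LETerm L.toLESig} {ε' : ℕ → ℤˣ}
    (hC : (∀ p, C p = .bot) ∨ t.NoCritical ε s)
    (hm : ∀ π x σ u, m π = some x → t.nodeAt s π = some (σ, u) → σ = -ε' x) :
    (extract C t m).NoCritical ε' s := by
  intro l p hl
  obtain ⟨π, u, h1, h2⟩ := h.exists_marked hC hl
  exact units_ne_neg_self _ (hm _ _ _ _ h1 h2)

/-- Extraction keeps the definite skeleton on the critical branches, at the end of which the
substituted terms are attached. -/
theorem Extractable.skeletonTree {m : List ℕ → Option ℕ} {s : ℤˣ} {t : LETerm L.star}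
    (h : Extractable ε m s t) (ht : t.IsVerySimpleSahlqvistTree ε s) {C : ℕ → LETerm L.toLESig}
    {Ω' : ℕ → ℕ → Prop} {ε' : ℕ → ℤˣ}
    (hm : ∀ π x σ u, m π = some x → t.nodeAt s π = some (σ, u) → σ = -ε' x)
    (hC : ∀ p, (C p).MeetPIATree Ω' ε' (ε p)) : (extract C t m).SkeletonTree Ω' ε' s := by
  have hno : ∀ {m s t}, Extractable ε m s t →
      (∀ π x σ u, m π = some x → t.nodeAt s π = some (σ, u) → σ = -ε' x) → t.NoCritical ε s →
      (extract C t m).SkeletonTree Ω' ε' s := fun h hm ht =>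
    .meetPIA (.noCritical (h.noCritical (Or.inr ht) hm))
  have hroot : ∀ {s} {t : LETerm L.star}, t.IsVerySimpleSahlqvistTree ε s →
      ¬ t.IsDefSkeleton s [] → (∀ p, t ≠ .var p) → t.NoCritical ε s := by
    rintro s t ht hsk hv (_ | ⟨n, l⟩) p hl
    · simp only [IsCritical, nodeAt_nil, Option.some.injEq, Prod.mk.injEq] at hl
      exact hv p hl.2
    · exact hsk (ht _ p hl [] (List.nil_prefix) (by simp))
  induction h with
  | marked x hx =>
    refine .meetPIA (.noCritical ?_)
    rw [extract_of_marked hx]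
    rintro (_ | ⟨n, l⟩) p hl
    · simp only [IsCritical, nodeAt_nil, Option.some.injEq, Prod.mk.injEq, var.injEq] at hl
      obtain ⟨h1, rfl⟩ := hl
      exact units_ne_neg_self _ (h1 ▸ hm [] x _ _ hx rfl)
    · simp [IsCritical] at hl
  | critical p hp =>
    simp only [extract, hp, markOr]
    exact .meetPIA (hC p)
  | bot hp => exact hno (.bot hp) hm (hroot ht (by simp [IsDefSkeleton]) (by simp))
  | top hp => exact hno (.top hp) hm (hroot ht (by simp [IsDefSkeleton]) (by simp))
  | meet hp ha hb => exact hno (.meet hp ha hb) hm (hroot ht (by simp [IsDefSkeleton]) (by simp))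
  | join hp ha hb => exact hno (.join hp ha hb) hm (hroot ht (by simp [IsDefSkeleton]) (by simp))
  | @app m s h args hp hargs ih =>
    by_cases hs : s = L.fam h
    · subst hs
      have := SkeletonTree.app (Ω := Ω') (ε := ε') h
        (fun i => extract C (args i) fun π => m (i.val :: π)) fun i => ih i ?_ ?_
      · simpa only [extract, hp, markOr] using this
      · intro l p hl π hπ hne
        have := ht (i.val :: l) p ((nodeAt_star_app_cons _ (.base h) _ i _).trans hl) (i.val :: π)
          (List.cons_prefix_cons.mpr ⟨rfl, hπ⟩) (by simpa using hne)
        obtain ⟨h', args', h'n⟩ := this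
        exact ⟨h', args', (nodeAt_star_app_cons _ (.base h) _ i _).symm.trans h'n⟩
      · exact fun π x σ u hx hu => hm (i.val :: π) x σ u hx
          ((nodeAt_star_app_cons _ (.base h) _ i _).trans hu)
    · refine hno (.app h args hp hargs) hm (hroot ht ?_ (by simp))
      rintro ⟨h', args', hn⟩
      simp only [nodeAt_nil, Option.some.injEq, Prod.mk.injEq, app.injEq] at hn
      obtain ⟨h1, rfl, -⟩ := hn
      exact hs h1

/-! ### Inversion of residuation-conservative PIA paths -/

open Classical in
/-- The term built with the residual in `L` of the connective `c` in the coordinate `i`, from `acc`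
in that coordinate and `side j` in the others (with a dummy value if there is no residual). -/
noncomputable def invertStep (c : StarConn L) (i : Fin c.arity)
    (side : Fin c.arity → LETerm L.toLESig) (acc : LETerm L.toLESig) : LETerm L.toLESig :=
  if h : ∃ (k : L.Conn) (e : Fin (L.arity k) ≃ Fin c.arity), IsResidual c i (.base k) e then
    .app h.choose fun j => Function.update side i acc (h.choose_spec.choose j)
  else acc

/-- `invert m ρ t acc` solves the inequality between `acc` and `t` for the leaf of `t` at the end of
the path `ρ`: it replaces the connectives on the path by their residuals, from the root to the leaf.
The subtrees beside the path are subjected to the extraction given by the marking `m`. -/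
noncomputable def invert : (List ℕ → Option ℕ) → List ℕ → LETerm L.star → LETerm L.toLESig →
    LETerm L.toLESig
  | m, n :: ρ, .app c args, acc =>
    if hn : n < StarConn.arity c then
      invert (fun π => m (n :: π)) ρ (args ⟨n, hn⟩) (invertStep c ⟨n, hn⟩
        (fun j => extract (fun _ => .bot) (args j) fun π => m (j.val :: π)) acc)
    else acc
  | _, _, _, acc => acc

/-- The path `ρ` in the signed tree of `t` leads to a non-critical leaf labelled with `p`, through
residuation-conservative PIA nodes; the subtrees beside the path contain no critical leaf and are
extractable. -/
inductive IsInvertible (ε : ℕ → ℤˣ) (p : ℕ) :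
    (List ℕ → Option ℕ) → ℤˣ → LETerm L.star → List ℕ → Prop
  | nil (m) : IsInvertible ε p m (-ε p) (.var p) []
  | cons (m) (c : StarConn L) (args : Fin c.arity → LETerm L.star) (i : Fin c.arity) (ρ : List ℕ) :
      ResidConservative c i →
      (∀ j, j ≠ i → Extractable ε (fun π => m (j.val :: π)) (-c.fam * c.ord j) (args j)) →
      (∀ j, j ≠ i → (args j).NoCritical ε (-c.fam * c.ord j)) →
      IsInvertible ε p (fun π => m (i.val :: π)) (-c.fam * c.ord i) (args i) ρ →
      IsInvertible ε p m (-c.fam) (.app (S := L.star) c args) (i.val :: ρ)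

theorem invert_cons (m : List ℕ → Option ℕ) (c : StarConn L) (args : Fin c.arity → LETerm L.star)
    (i : Fin c.arity) (ρ : List ℕ) (acc : LETerm L.toLESig) :
    invert m (i.val :: ρ) (.app (S := L.star) c args) acc =
      invert (fun π => m (i.val :: π)) ρ (args i) (invertStep c i
        (fun j => extract (fun _ => .bot) (args j) fun π => m (j.val :: π)) acc) := by
  rw [invert, dif_pos i.isLt]

theorem exists_invertStep_eq {c : StarConn L} {i : Fin c.arity} (h : ResidConservative c i)
    (side : Fin c.arity → LETerm L.toLESig) (acc : LETerm L.toLESig) :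
    ∃ (k : L.Conn) (e : Fin (L.arity k) ≃ Fin c.arity), IsResidual c i (.base k) e ∧
      invertStep c i side acc = .app k fun j => Function.update side i acc (e j) := by
  have h' : ∃ (k : L.Conn) (e : Fin (L.arity k) ≃ Fin c.arity), IsResidual c i (.base k) e := by
    obtain ⟨d, e, ⟨k, rfl⟩, hr⟩ := h
    exact ⟨k, e, hr⟩
  exact ⟨h'.choose, h'.choose_spec.choose, h'.choose_spec.choose_spec, dif_pos h'⟩

theorem PIATree.scope {p : ℕ} {s : ℤˣ} {S : LESig.{u}} {t : LETerm S} (h : t.PIATree Ω ε p s) :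
    ∀ q, t.Occurs q → q ≠ p → Ω q p := by
  cases h with
  | leaf =>
    rintro q ⟨_ | ⟨n, l⟩, σ, hl⟩ hq
    · simp only [nodeAt_nil, Option.some.injEq, Prod.mk.injEq, var.injEq] at hl
      exact absurd hl.2.symm hq
    · simp at hl
  | app h args i side scope main => exact scope

/-- Inverting a path turns a PIA branch for `x` into a longer one: the residual of a PIA node, in
the coordinate of the path, has the opposite sign at its root and is again a PIA node. -/
theorem IsInvertible.piaTree {p : ℕ} {m : List ℕ → Option ℕ} {s : ℤˣ} {t : LETerm L.star}
    {ρ : List ℕ} (h : IsInvertible ε p m s t ρ) {Ω' : ℕ → ℕ → Prop} {ε' : ℕ → ℤˣ} {x : ℕ}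
    (hm : ∀ π q σ u, π ≠ [] → m π = some q → t.nodeAt s π = some (σ, u) → σ = -ε' q ∧ Ω' q x)
    {acc : LETerm L.toLESig} (hacc : acc.PIATree Ω' ε' x (-s)) :
    (invert m ρ t acc).PIATree Ω' ε' x (ε p) := by
  induction h generalizing acc with
  | nil m => simpa [invert] using hacc
  | cons m c args i ρ hc hext hno _ ih =>
    rw [invert_cons]
    refine ih (fun π q σ u _ hq hu => hm (i.val :: π) q σ u (by simp) hq
      ((nodeAt_star_app_cons _ c _ i _).trans hu)) ?_
    obtain ⟨k, e, hr, heq⟩ := exists_invertStep_eq hc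
      (fun j => extract (fun _ => .bot) (args j) fun π => m (j.val :: π)) acc
    rw [heq]
    obtain ⟨h1, h2, h3⟩ := hr.signs
    change L.fam k = -c.ord i * c.fam at h1
    change L.ord k (e.symm i) = c.ord i at h2
    change ∀ j, j ≠ i → L.ord k (e.symm j) = -c.ord i * c.ord j at h3
    have hmj : ∀ (j : Fin c.arity) π q σ u, m (j.val :: π) = some q →
        (args j).nodeAt (-c.fam * c.ord j) π = some (σ, u) → σ = -ε' q ∧ Ω' q x :=
      fun j π q σ u hq hu => hm (j.val :: π) q σ u (by simp) hq
        ((nodeAt_star_app_cons _ c _ j _).trans hu)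
    have hs : -(-c.fam * c.ord i) = -L.fam k := by
      rw [h1]
      rcases Int.units_eq_one_or (c.ord i) with h | h <;> simp [h]
    rw [hs]
    refine .app (S := L.toLESig) k _ (e.symm i) (fun j hj => ?_) (fun q hq hqx => ?_) ?_
    · have hji : e j ≠ i := fun h => hj (by rw [← h]; simp)
      have hsj : -L.fam k * L.ord k j = -c.fam * c.ord (e j) := by
        have := h3 _ hji
        rw [Equiv.symm_apply_apply] at this
        rw [h1, this]
        rcases Int.units_eq_one_or (c.ord i) with h | h <;> simp [h]
      rw [hsj, Function.update_of_ne hji]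
      exact (hext _ hji).noCritical (Or.inl fun _ => rfl)
        fun π q σ u hq hu => (hmj _ π q σ u hq hu).1
    · obtain ⟨l, σ, hl⟩ := hq
      cases l with
      | nil => simp at hl
      | cons n l =>
        obtain ⟨j, rfl, hl₁⟩ := exists_of_nodeAt_app_cons hl
        by_cases hji : e j = i
        · rw [hji, Function.update_self] at hl₁
          exact hacc.scope q (occurs_of_nodeAt hl₁) hqx
        · rw [Function.update_of_ne hji] at hl₁
          obtain ⟨l', σ', hl'⟩ := (occurs_of_nodeAt hl₁).exists_nodeAt (-c.fam * c.ord (e j))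
          obtain ⟨π, u, hq, hu⟩ := (hext _ hji).exists_marked (Or.inl fun _ => rfl) hl'
          exact (hmj _ π q σ' u hq hu).2
    · have hsi : -L.fam k * L.ord k (e.symm i) = - -c.fam := by
        rw [h1, h2]
        rcases Int.units_eq_one_or (c.ord i) with h | h <;> simp [h]
      rw [hsi, Equiv.apply_symm_apply, Function.update_self]
      exact hacc

section Semantics

variable {A : Type v} [CompleteLattice A] (M : PerfectLE L A)

theorem signedLE_invertStep_iff {c : StarConn L} {i : Fin c.arity} (h : ResidConservative c i)
    (side : Fin c.arity → LETerm L.toLESig) (acc : LETerm L.toLESig) (w : ℕ → A) (b : A) :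
    signedLE (-c.fam * c.ord i) ((invertStep c i side acc).eval M.op w) b ↔
      signedLE (-c.fam) (acc.eval M.op w)
        (M.starOp c (Function.update (fun j => (side j).eval M.op w) i b)) := by
  obtain ⟨k, e, hr, heq⟩ := exists_invertStep_eq h side acc
  have := hr.signedLE_iff M (Function.update (fun j => (side j).eval M.op w) i b)
    (acc.eval M.op w)
  rw [signedLE_neg, this, neg_mul, signedLE_neg, heq, Function.update_idem, Function.update_self]
  have e1 : (fun j => (Function.update side i acc (e j)).eval M.op w) =
      Function.update (fun j => (side j).eval M.op w) i (acc.eval M.op w) ∘ e := by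
    funext j
    by_cases hj : e j = i
    · simp [hj]
    · simp [hj]
  rw [← e1]
  rfl

/-- Replacing the subtrees beside the path by their extractions. -/
theorem signedLE_starOp_update {c : StarConn L} {i : Fin c.arity}
    {args : Fin c.arity → LETerm L.star} {m : List ℕ → Option ℕ}
    (hext : ∀ j, j ≠ i → Extractable ε (fun π => m (j.val :: π)) (-c.fam * c.ord j) (args j))
    (hno : ∀ j, j ≠ i → (args j).NoCritical ε (-c.fam * c.ord j)) (κ : ℤˣ) (w v : ℕ → A)
    (hm : ∀ π q σ u, π ≠ [] → m π = some q →
      (LETerm.app (S := L.star) c args).nodeAt (-c.fam) π = some (σ, u) →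
      signedLE (κ * σ) (w q) (u.eval (S := L.star) M.starOp v)) :
    signedLE (κ * -c.fam)
      (M.starOp c (Function.update (fun j => (extract (fun _ => .bot) (args j)
        fun π => m (j.val :: π)).eval M.op w) i ((args i).eval (S := L.star) M.starOp v)))
      ((LETerm.app (S := L.star) c args).eval M.starOp v) := by
  refine M.starOp_mono c _ fun j => ?_
  by_cases hj : j = i
  · subst hj
    rw [Function.update_self]
    exact signedLE_refl _ _
  · rw [Function.update_of_ne hj, mul_assoc]
    exact (hext j hj).signedLE_eval M κ _ w v
      (fun π q σ u hq hu => hm (j.val :: π) q σ u (by simp) hq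
        ((nodeAt_star_app_cons _ c _ j _).trans hu))
      fun l p hl => absurd hl (hno j hj l p)

/-- One direction of residuation along the path: a bound of `t` yields a bound of the variable at the
end of the path, when extraction moves the subtrees beside the path in the right direction. -/
theorem IsInvertible.signedLE_invert {p : ℕ} {m : List ℕ → Option ℕ} {s : ℤˣ} {t : LETerm L.star}
    {ρ : List ℕ} (h : IsInvertible ε p m s t ρ) (w v : ℕ → A)
    (hm : ∀ π q σ u, π ≠ [] → m π = some q → t.nodeAt s π = some (σ, u) →
      signedLE (-σ) (w q) (u.eval (S := L.star) M.starOp v))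
    {acc : LETerm L.toLESig}
    (hacc : signedLE s (acc.eval M.op w) (t.eval (S := L.star) M.starOp v)) :
    signedLE (-ε p) ((invert m ρ t acc).eval M.op w) (v p) := by
  induction h generalizing acc with
  | nil m => simpa [invert, eval] using hacc
  | cons m c args i ρ hc hext hno _ ih =>
    rw [invert_cons]
    refine ih (fun π q σ u _ hq hu => hm (i.val :: π) q σ u (by simp) hq
      ((nodeAt_star_app_cons _ c _ i _).trans hu)) ?_
    rw [signedLE_invertStep_iff M hc]
    refine hacc.trans ?_
    have := signedLE_starOp_update M hext hno (-1) w v (by simpa using hm)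
    rwa [neg_one_mul, signedLE_neg] at this

/-- The converse direction of residuation along the path, under the opposite assumption on the
subtrees beside the path. -/
theorem IsInvertible.signedLE_of_invert {p : ℕ} {m : List ℕ → Option ℕ} {s : ℤˣ}
    {t : LETerm L.star} {ρ : List ℕ} (h : IsInvertible ε p m s t ρ) (w v : ℕ → A)
    (hm : ∀ π q σ u, π ≠ [] → m π = some q → t.nodeAt s π = some (σ, u) →
      signedLE σ (w q) (u.eval (S := L.star) M.starOp v))
    {acc : LETerm L.toLESig}
    (hacc : signedLE (-ε p) ((invert m ρ t acc).eval M.op w) (v p)) :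
    signedLE s (acc.eval M.op w) (t.eval (S := L.star) M.starOp v) := by
  induction h generalizing acc with
  | nil m => simpa [invert, eval] using hacc
  | cons m c args i ρ hc hext hno _ ih =>
    rw [invert_cons] at hacc
    have h1 := ih (fun π q σ u _ hq hu => hm (i.val :: π) q σ u (by simp) hq
      ((nodeAt_star_app_cons _ c _ i _).trans hu)) hacc
    rw [signedLE_invertStep_iff M hc] at h1
    refine h1.trans ?_
    have := signedLE_starOp_update M hext hno 1 w v (by simpa using hm)
    rwa [one_mul] at this

end Semantics

/-! ### Finite meets and joins of terms -/

/-- The meet of a list of terms for the sign `1`, and their join for the sign `-1`. -/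
def signedMeet {S : LESig.{u}} (s : ℤˣ) : List (LETerm S) → LETerm S
  | [] => if s = 1 then .top else .bot
  | a :: as => if s = 1 then .meet a (signedMeet s as) else .join a (signedMeet s as)

theorem meetPIATree_signedMeet {S : LESig.{u}} {s : ℤˣ} {as : List (LETerm S)}
    (h : ∀ a ∈ as, ∃ x, a.PIATree Ω ε x s) : (signedMeet s as).MeetPIATree Ω ε s := by
  induction as with
  | nil =>
    refine .noCritical fun l p hl => ?_
    rcases Int.units_eq_one_or s with rfl | rfl <;> cases l <;>
      simp [IsCritical, signedMeet] at hl
  | cons a as ih =>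
    obtain ⟨x, hx⟩ := h a (by simp)
    have ih := ih fun b hb => h b (by simp [hb])
    rcases Int.units_eq_one_or s with rfl | rfl
    · exact .meet (.pia x hx) ih
    · exact .join (.pia x hx) ih

variable {A : Type v} [CompleteLattice A] (M : PerfectLE L A)

theorem signedLE_eval_signedMeet {s : ℤˣ} {as : List (LETerm L.toLESig)} {w : ℕ → A} {b : A}
    (h : ∀ a ∈ as, signedLE s b (a.eval M.op w)) :
    signedLE s b ((signedMeet s as).eval M.op w) := by
  induction as with
  | nil => rcases Int.units_eq_one_or s with rfl | rfl <;> simp [signedMeet, signedLE, eval]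
  | cons a as ih =>
    have ih := ih fun b hb => h b (by simp [hb])
    have ha := h a (by simp)
    rcases Int.units_eq_one_or s with rfl | rfl <;> simp_all [signedMeet, signedLE, eval]

theorem eval_signedMeet_signedLE {s : ℤˣ} {as : List (LETerm L.toLESig)} {w : ℕ → A}
    {a : LETerm L.toLESig} (ha : a ∈ as) :
    signedLE s ((signedMeet s as).eval M.op w) (a.eval M.op w) := by
  induction as with
  | nil => simp at ha
  | cons b as ih =>
    rcases List.mem_cons.mp ha with rfl | ha
    · rcases Int.units_eq_one_or s with rfl | rfl <;> simp [signedMeet, signedLE, eval]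
    · have ih := ih ha
      rcases Int.units_eq_one_or s with rfl | rfl
      · simp only [signedLE, signedMeet, eval, if_true] at ih ⊢
        exact inf_le_right.trans ih
      · have h1 : ¬ ((-1 : ℤˣ) = 1) := by decide
        simp only [signedLE, signedMeet, eval, h1, if_false] at ih ⊢
        exact ih.trans le_sup_right

end LETerm

/-! ### Minimal-valuation subtrees -/

namespace LETerm

variable {L : LELang.{u}} {Ω : ℕ → ℕ → Prop} {ε : ℕ → ℤˣ}

/-- `l` is a non-critical leaf labelled with `p`. -/
def IsNonCriticalLeaf (ε : ℕ → ℤˣ) (s : ℤˣ) (t : LETerm L.star) (l : List ℕ) (p : ℕ) : Prop :=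
  ∃ σ, t.nodeAt s l = some (σ, .var p) ∧ σ ≠ ε p

theorem IsNonCriticalLeaf.nodeAt_eq {s : ℤˣ} {t : LETerm L.star} {l : List ℕ} {p : ℕ}
    (h : t.IsNonCriticalLeaf ε s l p) : t.nodeAt s l = some (-ε p, .var p) := by
  obtain ⟨σ, h1, h2⟩ := h
  rwa [← Int.units_ne_iff_eq_neg.mp h2]

/-- The condition on the new connectives in `NewConnectivesExtractable`, for a given assignment. -/
def NewConnectivesCovered (Ω : ℕ → ℕ → Prop) (ε : ℕ → ℤˣ) (s : ℤˣ) (t : LETerm L.star)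
    (τ : List ℕ → List ℕ) : Prop :=
  ∀ (π : List ℕ) (σ : ℤˣ) (c : StarConn L) (args : Fin c.arity → LETerm L.star),
    t.nodeAt s π = some (σ, .app (S := L.star) c args) → ¬ c.InBase →
      (∃ (l : List ℕ) (σ' : ℤˣ) (p : ℕ), t.nodeAt s l = some (σ', .var p) ∧ σ' ≠ ε p ∧
        τ l <+: π ∧ π <+: l) ∧
      (∃ r, (LETerm.app (S := L.star) c args).Occurs r ∧
        ∀ q, (LETerm.app (S := L.star) c args).Occurs q → q ≠ r → Ω q r)

variable {s : ℤˣ} {t : LETerm L.star} {τ : List ℕ → List ℕ}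

theorem IsMVAssignment.prefix (hτ : t.IsMVAssignment Ω ε s τ) {l : List ℕ} {σ : ℤˣ} {p : ℕ}
    (hl : t.nodeAt s l = some (σ, .var p)) : τ l <+: l := by
  rcases (hτ l σ p hl).1 with h | h
  · rw [h]
  · exact h.1

/-- The leaf that names a proper `MVTree` carries the `Ω`-largest variable of that tree. -/
theorem IsMVCandidate.lt_of_mem (hnew : t.NewConnectivesCovered Ω ε s τ)
    {l n : List ℕ} {σ : ℤˣ} {p : ℕ} (hl : t.nodeAt s l = some (σ, .var p))
    (hn : t.IsMVCandidate Ω ε s τ l p n) {l' : List ℕ} {σ' : ℤˣ} {q : ℕ}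
    (hl' : t.nodeAt s l' = some (σ', .var q)) (hnl' : n <+: l') : q ≠ p → Ω q p := by
  rcases hn with rfl | ⟨hp, -, -, h2, ⟨τ', c, args, hc, hcb⟩, -⟩
  · intro hq
    obtain rfl := eq_of_prefix_of_nodeAt_var hl hl' hnl'
    rw [hl] at hl'
    simp only [Option.some.injEq, Prod.mk.injEq, var.injEq] at hl'
    exact absurd hl'.2.symm hq
  · obtain ⟨-, r, hrocc, hr⟩ := hnew n τ' c args hc hcb
    have hocc : ∀ {l'' σ'' q'}, t.nodeAt s l'' = some (σ'', .var q') → n <+: l'' →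
        (LETerm.app (S := L.star) c args).Occurs q' := by
      rintro l'' σ'' q' h ⟨ρ, rfl⟩
      rw [nodeAt_append_of hc] at h
      exact occurs_of_nodeAt h
    have hpr : p = r := by
      by_contra hne
      have hlt := hr p (hocc hl hp) hne
      obtain ⟨l'', σ'', h⟩ := hrocc.exists_nodeAt τ'
      rw [← nodeAt_append_of hc] at h
      exact (h2 _ σ'' r (List.prefix_append _ _) h).1 hlt
    rw [hpr]
    exact hr q (hocc hl' hnl')

/-- The paths from the roots of the `MVTree`s to their leaves are pairwise disjoint. If two of them
met, then, with `l₁` to the left of `l₂`, either the root of `MVTree(l₂)` would lie on the path of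
`l₁`, or it would be admissible, and higher than the root chosen, for `l₁`. -/
theorem IsMVAssignment.disjoint_of_lt (hτ : t.IsMVAssignment Ω ε s τ)
    (hnew : t.NewConnectivesCovered Ω ε s τ) {l₁ l₂ π : List ℕ} {σ₁ σ₂ : ℤˣ} {p₁ p₂ : ℕ}
    (hl₁ : t.nodeAt s l₁ = some (σ₁, .var p₁)) (hl₂ : t.nodeAt s l₂ = some (σ₂, .var p₂))
    (h₁ : τ l₁ <+: π) (h₁' : π <+: l₁) (h₂ : τ l₂ <+: π) (h₂' : π <+: l₂) : ¬ l₁ < l₂ := by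
  intro hlt
  have hne : l₁ ≠ l₂ := ne_of_lt hlt
  obtain ⟨c₁, m₁⟩ := hτ l₁ σ₁ p₁ hl₁
  obtain ⟨c₂, -⟩ := hτ l₂ σ₂ p₂ hl₂
  rcases c₂ with h | ⟨-, hn₂, path₂, leaf₂, new₂, left₂⟩
  · rw [h] at h₂
    exact hne (eq_of_prefix_of_nodeAt_var hl₂ hl₁ (h₂.trans h₁')).symm
  have hnot : ¬ τ l₁ <+: τ l₂ := fun h => left₂ l₁ σ₁ p₁ hl₁ hlt ⟨h, h₂.trans h₁'⟩
  have hpre : τ l₂ <+: τ l₁ := by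
    rcases List.prefix_or_prefix_of_prefix h₁ h₂ with h | h
    · exact absurd h hnot
    · exact h
  have hn₁ : τ l₁ ≠ l₁ := by
    intro h
    rw [h] at h₁
    exact hne (eq_of_prefix_of_nodeAt_var hl₁ hl₂ (h₁.trans h₂'))
  have hp : p₁ = p₂ := by
    by_contra hp
    have := c₁.lt_of_mem hnew hl₁ hl₂ (h₁.trans h₂') (Ne.symm hp)
    exact (leaf₂ l₁ σ₁ p₁ (h₂.trans h₁') hl₁).1 this
  refine hnot (m₁ _ (Or.inr ⟨h₂.trans h₁', ?_, ?_, ?_, new₂, ?_⟩))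
  · intro h
    refine hnot ?_
    rw [h]
    exact h₁.trans h₁'
  · intro ρ i hρ hρl
    rcases List.prefix_or_prefix_of_prefix ((List.prefix_append ρ [i]).trans hρl)
      (h₁.trans h₁') with h | h
    · rcases eq_or_ne ρ (τ l₁) with he | he
      · rcases c₁ with hc | ⟨-, -, path₁, -⟩
        · exact absurd hc hn₁
        · exact path₁ ρ i (by rw [he]) hρl
      · -- Above the root of `MVTree(l₁)` the two paths agree.
        refine path₂ ρ i hρ (List.IsPrefix.trans ?_ (h₁.trans h₂'))
        refine List.prefix_of_prefix_length_le hρl (h₁.trans h₁') ?_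
        have := h.length_le
        have h' : ρ.length ≠ (τ l₁).length := fun hlen => he (h.eq_of_length hlen)
        simp only [List.length_append, List.length_singleton]
        omega
    · rcases c₁ with hc | ⟨-, -, path₁, -⟩
      · exact absurd hc hn₁
      · exact path₁ ρ i h hρl
  · rw [hp]
    exact leaf₂
  · exact fun l' σ q hl' hlt' => left₂ l' σ q hl' (hlt'.trans hlt)

theorem IsMVAssignment.disjoint (hτ : t.IsMVAssignment Ω ε s τ)
    (hnew : t.NewConnectivesCovered Ω ε s τ) {l₁ l₂ π : List ℕ} {σ₁ σ₂ : ℤˣ} {p₁ p₂ : ℕ}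
    (hl₁ : t.nodeAt s l₁ = some (σ₁, .var p₁)) (hl₂ : t.nodeAt s l₂ = some (σ₂, .var p₂))
    (h₁ : τ l₁ <+: π) (h₁' : π <+: l₁) (h₂ : τ l₂ <+: π) (h₂' : π <+: l₂) : l₁ = l₂ := by
  rcases lt_trichotomy l₁ l₂ with h | h | h
  · exact absurd h (hτ.disjoint_of_lt hnew hl₁ hl₂ h₁ h₁' h₂ h₂')
  · exact h
  · exact absurd h (hτ.disjoint_of_lt hnew hl₂ hl₁ h₂ h₂' h₁ h₁')

open Classical in
/-- The root of the `MVTree` of each non-critical leaf `l` is marked with the variable `code l`. -/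
noncomputable def mvMarking (ε : ℕ → ℤˣ) (s : ℤˣ) (t : LETerm L.star) (τ : List ℕ → List ℕ)
    (code : List ℕ → ℕ) (π : List ℕ) : Option ℕ :=
  if h : ∃ l p, t.IsNonCriticalLeaf ε s l p ∧ τ l = π then some (code h.choose) else none

theorem exists_of_mvMarking {code : List ℕ → ℕ} {π : List ℕ} {x : ℕ}
    (h : mvMarking ε s t τ code π = some x) :
    ∃ l p, t.IsNonCriticalLeaf ε s l p ∧ τ l = π ∧ x = code l := by
  unfold mvMarking at h
  split_ifs at h with hex
  obtain ⟨p, hp⟩ := hex.choose_spec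
  exact ⟨hex.choose, p, hp.1, hp.2, by simpa using h.symm⟩

theorem mvMarking_root (hτ : t.IsMVAssignment Ω ε s τ)
    (hnew : t.NewConnectivesCovered Ω ε s τ) (code : List ℕ → ℕ) {l : List ℕ} {p : ℕ}
    (hl : t.IsNonCriticalLeaf ε s l p) : mvMarking ε s t τ code (τ l) = some (code l) := by
  have hex : ∃ l' p, t.IsNonCriticalLeaf ε s l' p ∧ τ l' = τ l := ⟨l, p, hl, rfl⟩
  obtain ⟨p', hp', he⟩ := hex.choose_spec
  have : hex.choose = l := by
    refine hτ.disjoint hnew hp'.nodeAt_eq hl.nodeAt_eq (π := τ l) ?_ ?_ ?_ ?_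
    · rw [he]
    · have := hτ.prefix hp'.nodeAt_eq
      rwa [he] at this
    · exact List.prefix_rfl
    · exact hτ.prefix hl.nodeAt_eq
  rw [mvMarking, dif_pos hex, this]

theorem extractable_mvMarking (hτ : t.IsMVAssignment Ω ε s τ)
    (hnew : t.NewConnectivesCovered Ω ε s τ) (code : List ℕ → ℕ) :
    Extractable ε (mvMarking ε s t τ code) s t := by
  refine extractable_of_forall_exists_marked (fun l σ p hl hσ => ?_) fun π σ c args hc hcb => ?_
  · exact ⟨τ l, code l, hτ.prefix hl, mvMarking_root hτ hnew code ⟨σ, hl, hσ⟩⟩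
  · obtain ⟨⟨l, σ', p, hl, hσ, h1, -⟩, -⟩ := hnew π σ c args hc hcb
    exact ⟨τ l, code l, h1, mvMarking_root hτ hnew code ⟨σ', hl, hσ⟩⟩

/-- The `MVTree`s of the leaves beside the path of `l` do not reach up to that path. -/
theorem IsMVAssignment.prefix_of_ne (hτ : t.IsMVAssignment Ω ε s τ)
    (hnew : t.NewConnectivesCovered Ω ε s τ) {l l' π : List ℕ} {σ σ' : ℤˣ} {p p' i j : ℕ}
    (hl : t.nodeAt s l = some (σ, .var p)) (hl' : t.nodeAt s l' = some (σ', .var p'))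
    (h : τ l <+: π) (hi : π ++ [i] <+: l) (hj : π ++ [j] <+: l') (hij : j ≠ i) :
    π ++ [j] <+: τ l' := by
  rcases List.prefix_or_prefix_of_prefix hj (hτ.prefix hl') with h1 | h1
  · exact h1
  · rcases eq_or_ne (τ l') (π ++ [j]) with he | he
    · rw [he]
    · exfalso
      have h2 : τ l' <+: π := by
        rcases List.prefix_concat_iff.mp h1 with h2 | h2
        · exact absurd h2 he
        · exact h2
      obtain rfl := hτ.disjoint hnew hl hl' h ((List.prefix_append _ _).trans hi) h2
        ((List.prefix_append _ _).trans hj)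
      have h3 := (List.prefix_of_prefix_length_le hi hj (by simp)).eq_of_length (by simp)
      simp at h3
      exact hij h3.symm

/-- The path from the root of `MVTree(l)` to `l` can be inverted in `L`. -/
theorem IsMVAssignment.isInvertible (hτ : t.IsMVAssignment Ω ε s τ)
    (hnew : t.NewConnectivesCovered Ω ε s τ) (code : List ℕ → ℕ) {l : List ℕ} {p : ℕ}
    (hl : t.IsNonCriticalLeaf ε s l p) :
    ∀ (ρ π : List ℕ) (σ : ℤˣ) (u : LETerm L.star), π ++ ρ = l → τ l <+: π →
      t.nodeAt s π = some (σ, u) →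
      IsInvertible ε p (fun ν => mvMarking ε s t τ code (π ++ ν)) σ u ρ := by
  intro ρ
  induction ρ with
  | nil =>
    intro π σ u h1 _ h3
    rw [List.append_nil] at h1
    rw [h1, hl.nodeAt_eq] at h3
    simp only [Option.some.injEq, Prod.mk.injEq] at h3
    obtain ⟨rfl, rfl⟩ := h3
    exact .nil _
  | cons n ρ ih =>
    intro π σ u h1 h2 h3
    have hpl : π ++ [n] <+: l := ⟨ρ, by simp [← h1]⟩
    rcases (hτ l _ p hl.nodeAt_eq).1 with hc | ⟨-, -, hpath, hleaf, -, -⟩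
    · have := h2.length_le
      rw [hc, ← h1] at this
      simp at this
    obtain ⟨c, args, hi, hn, hcons⟩ := hpath π n h2 hpl
    rw [h3] at hn
    simp only [Option.some.injEq, Prod.mk.injEq] at hn
    obtain ⟨rfl, rfl⟩ := hn
    have hchild : ∀ (j : Fin c.arity) ν, t.nodeAt s (π ++ [j.val] ++ ν) =
        (args j).nodeAt (-c.fam * c.ord j) ν := by
      intro j ν
      rw [List.append_assoc, nodeAt_append_of h3]
      exact nodeAt_star_app_cons _ c args j ν
    have hshift : ∀ j : ℕ, (fun ν => mvMarking ε s t τ code (π ++ j :: ν)) =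
        fun ν => mvMarking ε s t τ code (π ++ [j] ++ ν) := by
      intro j
      funext ν
      simp
    refine .cons _ c args ⟨n, hi⟩ ρ hcons (fun j hj => ?_) (fun j hj l' q hq => ?_) ?_
    · rw [hshift]
      have hjn : j.val ≠ n := fun h => hj (Fin.ext h)
      have hroot : ∀ {l' q}, t.IsNonCriticalLeaf ε s l' q → π ++ [j.val] <+: l' →
          ∃ π', τ l' = π ++ [j.val] ++ π' ∧
            mvMarking ε s t τ code (π ++ [j.val] ++ π') = some (code l') := by
        intro l' q hl' hpre
        obtain ⟨π', hπ'⟩ :=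
          hτ.prefix_of_ne hnew hl.nodeAt_eq hl'.nodeAt_eq h2 hpl hpre hjn
        exact ⟨π', hπ'.symm, by rw [hπ']; exact mvMarking_root hτ hnew code hl'⟩
      refine extractable_of_forall_exists_marked (fun ν σ q hν hσ => ?_)
        fun ν σ d args' hd hdb => ?_
      · rw [← hchild] at hν
        obtain ⟨π', h4, h5⟩ := hroot ⟨σ, hν, hσ⟩ (List.prefix_append _ _)
        refine ⟨π', _, ?_, h5⟩
        have := hτ.prefix hν
        rwa [h4, List.prefix_append_right_inj] at this
      · rw [← hchild] at hd
        obtain ⟨⟨l', σ', q, hl', hσ', h6, h7⟩, -⟩ := hnew _ σ d args' hd hdb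
        obtain ⟨π', h4, h5⟩ := hroot ⟨σ', hl', hσ'⟩ ((List.prefix_append _ _).trans h7)
        refine ⟨π', _, ?_, h5⟩
        rwa [h4, List.prefix_append_right_inj] at h6
    · have hq' := (hchild j l').trans hq
      exact (hleaf _ _ q (h2.trans (by simp)) hq').2 rfl
    · have := ih (π ++ [n]) (-c.fam * c.ord ⟨n, hi⟩) (args ⟨n, hi⟩) (by simp [← h1])
        (h2.trans (List.prefix_append _ _))
        (by simpa using hchild ⟨n, hi⟩ [])
      rw [hshift]
      exact this

end LETerm

/-! ### The refined inductive inequality -/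

open LETerm

/-- The sign of the root of the generation tree of the left-hand side (`true`) or of the right-hand
side (`false`) of an inequality. -/
def CryptoData.sign (b : Bool) : ℤˣ := if b then 1 else -1

/-- The two generation trees of an inequality, with the data from crypto-inductivity. The tree with
index `true` is the positive one of the left-hand side, that with index `false` the negative one of
the right-hand side. -/
structure CryptoData (L : LELang.{u}) where
  tree : Bool → LETerm L.star
  root : Bool → List ℕ → List ℕ
  Ω : ℕ → ℕ → Prop
  ε : ℕ → ℤˣ
  strict : IsStrictPO Ω
  assignment : ∀ b, (tree b).IsMVAssignment Ω ε (CryptoData.sign b) (root b)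
  covered : ∀ b, (tree b).NewConnectivesCovered Ω ε (CryptoData.sign b) (root b)

namespace CryptoData

variable {L : LELang.{u}} (D : CryptoData L)

/-- The fresh variable for the leaf `l` of the tree `b`. -/
def code (b : Bool) (l : List ℕ) : ℕ := Encodable.encode (b, l)

/-- The leaf that a fresh variable stands for (an arbitrary one, if the number is not a code). -/
def leaf (x : ℕ) : Bool × List ℕ := (Encodable.decode x).getD (true, [])

@[simp] theorem leaf_code (b : Bool) (l : List ℕ) : leaf (code b l) = (b, l) := by
  simp [leaf, code]

/-- The root of the `MVTree` that is replaced by the fresh variable. -/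
def rootOf (x : ℕ) : List ℕ := D.root (leaf x).1 (leaf x).2

/-- The signed `MVTree` that is replaced by a fresh variable. -/
def subtree (x : ℕ) : Option (ℤˣ × LETerm L.star) :=
  (D.tree (leaf x).1).nodeAt (sign (leaf x).1) (D.rootOf x)

/-- The order type on the fresh variables: the occurrence of `x` in place of the `MVTree` is not
critical. The value on other numbers is irrelevant. -/
def newType (x : ℕ) : ℤˣ := -((D.subtree x).map Prod.fst).getD 1

/-- The label of the leaf that a fresh variable stands for (`0`, if there is no such leaf). -/
def label (x : ℕ) : ℕ :=
  match (D.tree (leaf x).1).nodeAt (sign (leaf x).1) (leaf x).2 with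
  | some (_, .var p) => p
  | _ => 0

/-- Fresh variables are ordered by the labels of their leaves, and in case of equal labels by
inclusion of the subtrees for which they stand. -/
def newOrder (y x : ℕ) : Prop :=
  D.Ω (D.label y) (D.label x) ∨ D.label y = D.label x ∧ (leaf y).1 = (leaf x).1 ∧
    D.rootOf x <+: D.rootOf y ∧ D.rootOf x ≠ D.rootOf y

theorem newOrder_strict : IsStrictPO D.newOrder := by
  obtain ⟨h1, h2⟩ := D.strict
  refine ⟨fun p hp => ?_, fun p q r hpq hqr => ?_⟩
  · rcases hp with h | ⟨-, -, -, h⟩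
    · exact h1 _ h
    · exact h rfl
  · rcases hpq with h | ⟨e1, e2, e3, e4⟩ <;> rcases hqr with h' | ⟨e1', e2', e3', e4'⟩
    · exact Or.inl (h2 _ _ _ h h')
    · exact Or.inl (e1' ▸ h)
    · exact Or.inl (e1 ▸ h')
    · refine Or.inr ⟨e1.trans e1', e2.trans e2', e3'.trans e3, fun h => e4' ?_⟩
      exact e3'.eq_of_length_le (by rw [h]; exact e3.length_le)

/-- The marking of the tree `b`. -/
noncomputable def marking (b : Bool) : List ℕ → Option ℕ :=
  mvMarking D.ε (sign b) (D.tree b) (D.root b) (code b)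

/-- The non-critical leaves of the tree `b`. -/
abbrev NonCritical (b : Bool) (l : List ℕ) (p : ℕ) : Prop :=
  (D.tree b).IsNonCriticalLeaf D.ε (sign b) l p

variable {D}

theorem NonCritical.exists_subtree {b : Bool} {l : List ℕ} {p : ℕ} (h : D.NonCritical b l p) :
    ∃ σ u, (D.tree b).nodeAt (sign b) (D.root b l) = some (σ, u) :=
  nodeAt_isSome_of_prefix h.nodeAt_eq ((D.assignment b).prefix h.nodeAt_eq)

theorem NonCritical.label_code {b : Bool} {l : List ℕ} {p : ℕ} (h : D.NonCritical b l p) :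
    D.label (code b l) = p := by
  simp only [label, leaf_code, h.nodeAt_eq]

theorem exists_of_marking {b : Bool} {π : List ℕ} {x : ℕ} (h : D.marking b π = some x) :
    ∃ l p, D.NonCritical b l p ∧ D.root b l = π ∧ x = code b l :=
  exists_of_mvMarking h

theorem subtree_of_marking {b : Bool} {π : List ℕ} {x : ℕ} (h : D.marking b π = some x) :
    D.subtree x = (D.tree b).nodeAt (sign b) π := by
  obtain ⟨l, p, -, rfl, rfl⟩ := exists_of_marking h
  simp [subtree, rootOf]

theorem sign_of_marking {b : Bool} {π : List ℕ} {x : ℕ} {σ : ℤˣ} {u : LETerm L.star}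
    (h : D.marking b π = some x) (hu : (D.tree b).nodeAt (sign b) π = some (σ, u)) :
    σ = -D.newType x := by
  simp [newType, subtree_of_marking h, hu]

theorem NonCritical.isInvertible {b : Bool} {l : List ℕ} {p : ℕ} (h : D.NonCritical b l p)
    {σ : ℤˣ} {u : LETerm L.star}
    (hu : (D.tree b).nodeAt (sign b) (D.root b l) = some (σ, u)) :
    IsInvertible D.ε p (fun ν => D.marking b (D.root b l ++ ν)) σ u
      (l.drop (D.root b l).length) := by
  refine (D.assignment b).isInvertible (D.covered b) (code b) h _ _ _ _ ?_
    List.prefix_rfl hu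
  exact List.prefix_iff_eq_append.mp ((D.assignment b).prefix h.nodeAt_eq)

/-- The fresh variables beside the path in `MVTree(l)` are below the fresh variable of `l`. -/
theorem NonCritical.newOrder_of_marking {b : Bool} {l : List ℕ} {p : ℕ} (h : D.NonCritical b l p)
    {ν : List ℕ} {y : ℕ} (hν : ν ≠ []) (hy : D.marking b (D.root b l ++ ν) = some y) :
    D.newOrder y (code b l) := by
  obtain ⟨l', q, h', hr, rfl⟩ := exists_of_marking hy
  have hlt := ((D.assignment b) l _ p h.nodeAt_eq).1.lt_of_mem (D.covered b) h.nodeAt_eq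
    h'.nodeAt_eq
    (((List.prefix_append _ ν).trans (by rw [hr])).trans
      ((D.assignment b).prefix h'.nodeAt_eq))
  by_cases hq : q = p
  · refine Or.inr ⟨?_, by simp, ?_, ?_⟩
    · rw [h'.label_code, h.label_code, hq]
    · simp [rootOf, hr]
    · simpa [rootOf, hr] using hν
  · left
    rw [h'.label_code, h.label_code]
    exact hlt hq

variable (D)

/-- The solution, for the label of the leaf `l`, of the inequality between the fresh variable of `l`
and the `MVTree` of `l`. -/
noncomputable def solution (b : Bool) (l : List ℕ) : LETerm L.toLESig :=
  invert (fun ν => D.marking b (D.root b l ++ ν)) (l.drop (D.root b l).length)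
    (((D.subtree (code b l)).map Prod.snd).getD .bot) (.var (code b l))

theorem finite_nonCritical (p : ℕ) :
    {bl : Bool × List ℕ | D.NonCritical bl.1 bl.2 p}.Finite := by
  refine ((Set.finite_iUnion fun b : Bool =>
    (finite_nodes (sign b) (D.tree b)).image (Prod.mk b))).subset ?_
  rintro ⟨b, l⟩ h
  exact Set.mem_iUnion.mpr ⟨b, l, by simp [h.nodeAt_eq], rfl⟩

/-- The minimal valuation of the variable `p` (the maximal one, if `ε p = 1`). -/
noncomputable def minimalValuation (p : ℕ) : LETerm L.toLESig :=
  signedMeet (D.ε p) ((D.finite_nonCritical p).toFinset.toList.map fun bl => D.solution bl.1 bl.2)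

/-- The two sides of the inequality in `L`. -/
noncomputable def result (b : Bool) : LETerm L.toLESig :=
  extract D.minimalValuation (D.tree b) (D.marking b)

theorem solution_eq {b : Bool} {l : List ℕ} {σ : ℤˣ} {u : LETerm L.star}
    (hu : (D.tree b).nodeAt (sign b) (D.root b l) = some (σ, u)) :
    D.solution b l = invert (fun ν => D.marking b (D.root b l ++ ν))
      (l.drop (D.root b l).length) u (.var (code b l)) := by
  have : D.subtree (code b l) = some (σ, u) := by simp [subtree, rootOf, hu]
  rw [solution, this]
  rfl

theorem meetPIATree_minimalValuation (p : ℕ) :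
    (D.minimalValuation p).MeetPIATree D.newOrder D.newType (D.ε p) := by
  refine meetPIATree_signedMeet fun a ha => ?_
  obtain ⟨⟨b, l⟩, hbl, rfl⟩ := List.mem_map.mp ha
  have h : D.NonCritical b l p := by simpa using hbl
  obtain ⟨σ, u, hu⟩ := h.exists_subtree
  refine ⟨code b l, ?_⟩
  dsimp only
  rw [D.solution_eq hu]
  refine (h.isInvertible hu).piaTree (fun π q σ' u' hπ hq hu' => ?_) ?_
  · rw [← nodeAt_append_of hu] at hu'
    exact ⟨sign_of_marking hq hu', h.newOrder_of_marking hπ hq⟩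
  · have hσ : -σ = D.newType (code b l) := by simp [newType, subtree, rootOf, hu]
    rw [hσ]
    exact .leaf

theorem extractable (b : Bool) : Extractable D.ε (D.marking b) (sign b) (D.tree b) :=
  extractable_mvMarking (D.assignment b) (D.covered b) (code b)

theorem isRefinedInductiveTree_result (b : Bool)
    (h : (D.tree b).IsVerySimpleSahlqvistTree D.ε (sign b)) :
    (D.result b).IsRefinedInductiveTree D.newOrder D.newType (sign b) :=
  ((D.extractable b).skeletonTree h (fun _ _ _ _ h1 h2 => sign_of_marking h1 h2)
    D.meetPIATree_minimalValuation).isRefinedInductiveTree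

variable {A : Type v} [CompleteLattice A] (M : PerfectLE L A)

/-- If the fresh variables take the values of the subtrees for which they stand, then the minimal
valuations approximate the original variables. -/
theorem result_signedLE (v : ℕ → A) :
    ∃ w : ℕ → A, ∀ b, signedLE (-sign b) ((D.result b).eval M.op w)
      ((D.tree b).eval (S := L.star) M.starOp v) := by
  refine ⟨fun x => (((D.subtree x).map Prod.snd).getD .bot).eval (S := L.star) M.starOp v,
    fun b => ?_⟩
  have hm : ∀ b π x σ u, D.marking b π = some x →
      (D.tree b).nodeAt (sign b) π = some (σ, u) →
      (((D.subtree x).map Prod.snd).getD .bot).eval (S := L.star) M.starOp v =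
        u.eval (S := L.star) M.starOp v := by
    intro b π x σ u hx hu
    rw [subtree_of_marking hx, hu]
    rfl
  have := (D.extractable b).signedLE_eval M (-1) D.minimalValuation
    (fun x => (((D.subtree x).map Prod.snd).getD .bot).eval (S := L.star) M.starOp v) v ?_ ?_
  · rwa [neg_one_mul] at this
  · intro π x σ u hx hu
    rw [hm b π x σ u hx hu]
    exact signedLE_refl _ _
  · intro l p _
    rw [neg_one_mul, signedLE_neg]
    refine signedLE_eval_signedMeet M fun a ha => ?_
    obtain ⟨⟨b, l⟩, hbl, rfl⟩ := List.mem_map.mp ha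
    have h : D.NonCritical b l p := by simpa using hbl
    obtain ⟨σ, u, hu⟩ := h.exists_subtree
    dsimp only
    rw [D.solution_eq hu, ← signedLE_neg]
    refine (h.isInvertible hu).signedLE_invert M _ v (fun π q σ' u' _ hq hu' => ?_) ?_
    · rw [← nodeAt_append_of hu] at hu'
      rw [hm b _ q σ' u' hq hu']
      exact signedLE_refl _ _
    · have : D.subtree (code b l) = some (σ, u) := by simp [subtree, rootOf, hu]
      simp only [eval, this]
      exact signedLE_refl _ _

/-- If the original variables take the values of the minimal valuations, then the fresh variables
approximate the subtrees for which they stand. -/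
theorem signedLE_result (w : ℕ → A) :
    ∃ v : ℕ → A, ∀ b, signedLE (sign b) ((D.result b).eval M.op w)
      ((D.tree b).eval (S := L.star) M.starOp v) := by
  refine ⟨fun p => (D.minimalValuation p).eval M.op w, fun b => ?_⟩
  obtain ⟨v, hv⟩ : ∃ v : ℕ → A, v = fun p => (D.minimalValuation p).eval M.op w := ⟨_, rfl⟩
  rw [← hv]
  obtain ⟨N, hN⟩ := ((finite_nodes (sign b) (D.tree b)).image List.length).bddAbove
  -- Induction on the height of the marked node: the subtrees beside the path contain only lower
  -- marked nodes.
  have key : ∀ k π x σ u, N < π.length + k → D.marking b π = some x →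
      (D.tree b).nodeAt (sign b) π = some (σ, u) →
      signedLE σ (w x) (u.eval (S := L.star) M.starOp v) := by
    intro k
    induction k with
    | zero =>
      intro π x σ u hk _ hu
      have := hN ⟨π, by simp [hu], rfl⟩
      omega
    | succ k ih =>
      intro π x σ u hk hx hu
      obtain ⟨l, p, h, rfl, rfl⟩ := exists_of_marking hx
      refine (h.isInvertible hu).signedLE_of_invert M w v (fun π q σ' u' hπ hq hu' => ?_)
        (acc := .var (code b l)) ?_
      · rw [← nodeAt_append_of hu] at hu'
        refine ih _ q σ' u' ?_ hq hu'
        have := List.length_pos_iff.mpr hπ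
        rw [List.length_append]
        omega
      · rw [← D.solution_eq hu, signedLE_neg, hv]
        refine eval_signedMeet_signedLE M (List.mem_map.mpr ⟨(b, l), ?_, rfl⟩)
        simpa using h
  have := (D.extractable b).signedLE_eval M 1 D.minimalValuation w v
    (fun π x σ u hx hu => by
      rw [one_mul]
      exact key (N + 1) π x σ u (by omega) hx hu)
    (fun l p _ => by
      rw [one_mul, hv]
      exact signedLE_refl _ _)
  rwa [one_mul] at this

theorem valid_iff : M.StarValid (D.tree true) (D.tree false) ↔
    M.Valid (D.result true) (D.result false) := by
  constructor
  · intro h w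
    obtain ⟨v, hv⟩ := D.signedLE_result M w
    have h1 := hv true
    have h2 := hv false
    simp only [sign, if_true, Bool.false_eq_true, if_false, signedLE_neg] at h1 h2
    simp only [signedLE, if_true] at h1 h2
    exact h1.trans ((h v).trans h2)
  · intro h v
    obtain ⟨w, hw⟩ := D.result_signedLE M v
    have h1 := hw true
    have h2 := hw false
    simp only [sign, if_true, Bool.false_eq_true, if_false, signedLE_neg] at h1 h2
    simp only [signedLE, if_true] at h1 h2
    exact h1.trans ((h w).trans h2)

end CryptoData

theorem mainTheorem3 (L : LELang.{u}) (φ ψ : LETerm L.star) (hcrypto : IsCryptoInductive φ ψ) :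
    ∃ (s t : LETerm L.toLESig) (Ω' : ℕ → ℕ → Prop) (ε' : ℕ → ℤˣ),
      IsRefinedInductive Ω' ε' s t ∧
      ∀ (A : Type v) [CompleteLattice A] (M : PerfectLE L A),
        M.StarValid φ ψ ↔ M.Valid s t := by
  obtain ⟨ε, ⟨hφ, hψ⟩, -, Ω, hΩ, ⟨τ₁, hτ₁, hnew₁⟩, ⟨τ₂, hτ₂, hnew₂⟩⟩ := hcrypto
  let D : CryptoData L :=
    { tree := fun b => if b then φ else ψ
      root := fun b => if b then τ₁ else τ₂
      Ω := Ω
      ε := ε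
      strict := hΩ
      assignment := by rintro (_ | _) <;> assumption
      covered := by rintro (_ | _) <;> assumption }
  obtain ⟨s, t, hst, hvalid⟩ := exists_isRefinedInductive.{u, v}
    (s := D.result true) (t := D.result false) (Ω := D.newOrder) (ε := D.newType)
    ⟨D.newOrder_strict, D.isRefinedInductiveTree_result true hφ,
      D.isRefinedInductiveTree_result false hψ⟩
  exact ⟨s, t, D.newOrder, D.newType, hst, fun A _ M => (D.valid_iff M).trans (hvalid A M)⟩
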